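/- Let $X$ be a real or complex Banach space and let $\mathcal P,\mathcal Q$ be bounded operators on $X$ with $\mathcal P+\mathcal Q=\mathcal I$ and $\mathcal P\mathcal Q=0$. Let $\mathcal L$ be a (possibly unbounded) linear operator in $X$ such that $\mathcal L$ and $\mathcal Q\mathcal L$ are closable and their closures generate strongly continuous semigroups $e^{t\mathcal L}$ and $e^{t\mathcal Q\mathcal L}$, $t\ge 0$; below, $\mathcal L$ also denotes its closure. Assume differentiability in time up to any order: $\operatorname{Ran}\mathcal P\subset D(\mathcal L^n)$ for all $n$, and for every $x\in X$ one has $e^{t\mathcal Q\mathcal L}\mathcal Q\mathcal L\mathcal Px\in D(\mathcal L)$ for all $t\ge 0$ and the memory kernel $t\mapsto \mathcal P\mathcal Le^{t\mathcal Q\mathcal L}\mathcal Q\mathcal L\mathcal Px$ is $C^\infty$ on $[0,\infty)$. Write $a_i=\mathcal P\mathcal L^i\mathcal P$, and let $$\tilde P_0=\mathcal I,\quad \tilde P_n=\sum_{k=0}^{n-1}(-1)^{\delta_{k0}+1}a_{n-k}\tilde P_k\ (n\ge1),\qquad \hat B_{n,k}=\sum_{\substack{j_1+\cdots+j_k=n\\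 j_i\ge 1}}\frac{1}{k!}\,\frac{n!}{j_1!\cdots j_k!}\,a_{j_1}\cdots a_{j_k}.$$ Suppose that $\mathcal P\mathcal L^{2k+1}\mathcal P=0$ for all $k\ge 0$, and that there is a subspace $V\supset\operatorname{Ran}\mathcal P$ of $X$ such that $\mathcal P\mathcal L^2\mathcal P$ maps $V$ to $V$ and $a_2|_V=\mathcal P\mathcal L^2\mathcal P|_V:V\to V$ is invertible. Then there are bounded operators $\mathcal F'_n$, $n\ge0$, with $\mathcal F'_n\mathcal P=\mathcal F'_n$, which form the unique sequence of linear operators with this property that solves $$\mathcal F'_0=\mathcal P\mathcal L^2\mathcal P-(\mathcal P\mathcal L\mathcal P)^2,\qquad \tilde P_{n+2}=\sum_{k=1}^{n}\mathcal F'_k\hat B_{n,k}\quad(n\ge1),$$ and which are constructed recursively from the equations of even order: on $V$, $$\mathcal F'_n=\frac{n!\,2^n}{(2n)!}\Bigl(\tilde P_{2n+2}-\sum_{k=1}^{n-1}\mathcal F'_k\hat B_{2n,k}\Bigr)\bigl(\mathcal P\mathcal L^2\mathcal P|_V\bigr)^{-n},\qquad n\ge 1,$$ such that the differential-form Dyson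 identity has the combinatorial expansion $$\frac{d}{dt}\mathcal Pe^{t\mathcal L}\mathcal P=\mathcal Pe^{t\mathcal L}\mathcal P\mathcal L\mathcal P+\sum_{n=0}^\infty\sum_{k=0}^n\frac{(-1)^{n-k}}{(n-k)!\,k!}\int_0^t\mathcal Pe^{(t-s)\mathcal L}\mathcal F'_n\bigl(\mathcal Pe^{s\mathcal L}\mathcal P\bigr)^k\,ds$$ in the following sense. (1) To all orders in $t$: for every $x\in X$ the function $t\mapsto\mathcal Pe^{t\mathcal L}\mathcal Px$ is differentiable on $[0,\infty)$ and, for every $N$, when both sides are applied to $x$ and the sum over $n$ is truncated after $n=N$, the difference of the two sides is $O(t^{2N+3})$ as $t\to0^+$. (2) As a convergent series, if the Taylor series converge: if for some $r>0$ and all $x\in X$ the Taylor series at $t=0$ of $\mathcal Pe^{t\mathcal L}\mathcal Px$ and of $\mathcal P\mathcal Le^{t\mathcal Q\mathcal L}\mathcal Q\mathcal L\mathcal Px$ converge to these functions for $0\le t<r$, then there is $\delta>0$ such that for all $x\in X$ and $0\le t<\delta$ the series over $n$, applied to $x$, converges and the identity, applied to $x$, holds exactly. -/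

import Mathlib

open Set Filter Topology
open scoped Nat ContDiff Asymptotics

noncomputable section

namespace MoriZwanzig

/-! Strongly continuous semigroups and generators -/

section Semigroup

variable {𝕜 X : Type*} [RCLike 𝕜] [NormedAddCommGroup X] [NormedSpace ℝ X] [NormedSpace 𝕜 X]

/-- `T t`, `t ≥ 0`, is a strongly continuous one-parameter semigroup of bounded operators.
The values `T t` for `t < 0` are irrelevant. -/
structure IsC0Semigroup (T : ℝ → X →L[𝕜] X) : Prop where
  zero : T 0 = 1
  add : ∀ s t : ℝ, 0 ≤ s → 0 ≤ t → T (s + t) = T s * T t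
  tendsto : ∀ x : X, Tendsto (fun t => T t x) (𝓝[>] 0) (𝓝 x)

/-- `T` is a strongly continuous semigroup and the (unbounded) operator `A` is its infinitesimal
generator: `x ∈ D(A)` and `A x = y` if and only if `(T h x - x) / h → y` as `h → 0+`. -/
def Generates (A : X →ₗ.[𝕜] X) (T : ℝ → X →L[𝕜] X) : Prop :=
  IsC0Semigroup T ∧
    ∀ x y : X, (x, y) ∈ A.graph ↔
      Tendsto (fun h : ℝ => h⁻¹ • (T h x - x)) (𝓝[>] 0) (𝓝 y)

end Semigroup

/-! Unbounded operators -/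

section Unbounded

variable {𝕜 X : Type*} [Field 𝕜] [AddCommGroup X] [Module 𝕜 X]

/-- The composition `g ∘ f` of unbounded operators, with its maximal domain
`{x ∈ D(f) | f x ∈ D(g)}`. -/
def pcomp (g f : X →ₗ.[𝕜] X) : X →ₗ.[𝕜] X :=
  g.comp (f.domRestrict ((g.domain.comap f.toFun).map f.domain.subtype)) (by
    rintro x
    obtain ⟨y, hy, hyx⟩ := x.2.1
    have h : f.domRestrict ((g.domain.comap f.toFun).map f.domain.subtype) x = f y :=
      LinearPMap.domRestrict_apply hyx.symm
    exact h ▸ hy)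

/-- The power `A ^ n` of an unbounded operator, with its maximal domain. -/
def ppow (A : X →ₗ.[𝕜] X) : ℕ → X →ₗ.[𝕜] X
  | 0 => LinearMap.toPMap LinearMap.id ⊤
  | n + 1 => pcomp A (ppow A n)

/-- The everywhere defined operator `P Aⁿ P`, when `Ran P` is contained in `D(Aⁿ)`. -/
def compressedPow (P : Module.End 𝕜 X) (A : X →ₗ.[𝕜] X)
    (h : ∀ n, LinearMap.range P ≤ (ppow A n).domain) (n : ℕ) : Module.End 𝕜 X :=
  P ∘ₗ (ppow A n).toFun ∘ₗ P.codRestrict (ppow A n).domain (fun x => h n ⟨x, rfl⟩)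

open Classical in
/-- The value `A x`; it is only used at points `x ∈ D(A)`. -/
def pval (A : X →ₗ.[𝕜] X) (x : X) : X :=
  if h : x ∈ A.domain then A ⟨x, h⟩ else 0

/-- `J` is the inverse of the restriction `A|_V : V → V`. -/
def IsInverseOn (V : Submodule 𝕜 X) (A : Module.End 𝕜 X) (J : Module.End 𝕜 V) : Prop :=
  (∀ v ∈ V, A v ∈ V) ∧ (∀ w : V, A (J w : X) = w) ∧ ∀ v w : V, A (v : X) = w → J w = v

end Unbounded

/-! Noncommutative polynomials, evaluated on a sequence of elements of an algebra -/

section Polynomials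

variable {𝕜 R : Type*} [Field 𝕜] [Ring R] [Algebra 𝕜 R]

/-- Noncommutative bipartition polynomials:
`P̃ 0 = 1` and `P̃ n = ∑_{k < n} (-1)^(δ_{k0} + 1) b_{n-k} P̃ k` for `n ≥ 1`. -/
def bipartition (b : ℕ → R) : ℕ → R
  | 0 => 1
  | n + 1 => ∑ k : Fin (n + 1),
      (-1) ^ ((if (k : ℕ) = 0 then 1 else 0) + 1) * b (n + 1 - k) * bipartition b k

/-- Noncommutative partial Bell polynomials of type II:
`B̂ n k = ∑ 1/k! * n!/(j₁! ⋯ j_k!) a_{j₁} ⋯ a_{j_k}`, the sum being over all words of `k` letters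
with `j₁ + ⋯ + j_k = n`, all `j_i ≥ 1`. -/
def bellII (𝕜 : Type*) [Field 𝕜] [Algebra 𝕜 R] (a : ℕ → R) (n k : ℕ) : R :=
  ∑ c : Composition n with c.length = k,
    ((1 / (k ! : 𝕜)) * ((n ! : 𝕜) / ((c.blocks.map Nat.factorial).prod : ℕ))) •
      (c.blocks.map a).prod

/-- The algebraic equation of words
`F 0 = P̃ 2`, `P̃ (n + 2) = ∑_{k=1}^n F k * B̂ n k` for all `n ≥ 1`. -/
def SolvesWordEquation (𝕜 : Type*) [Field 𝕜] [Algebra 𝕜 R] (a F : ℕ → R) : Prop :=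
  F 0 = a 2 - a 1 ^ 2 ∧
    ∀ n, 1 ≤ n → bipartition a (n + 2) = ∑ k ∈ Finset.Icc 1 n, F k * bellII 𝕜 a n k

end Polynomials

/-! The Mori-Zwanzig equation -/

section MZ

variable {𝕜 X : Type*} [RCLike 𝕜] [NormedAddCommGroup X] [NormedSpace ℝ X] [NormedSpace 𝕜 X]

/-- The function `t ↦ P e^{tL} P x`, where `T t = e^{tL}`. -/
def projected (P : X →L[𝕜] X) (T : ℝ → X →L[𝕜] X) (x : X) (t : ℝ) : X :=
  P (T t (P x))

/-- The memory kernel `t ↦ P L e^{tQL} Q L P x`, where `S t = e^{tQL}`. -/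
def memoryKernel (P Q : X →L[𝕜] X) (A : X →ₗ.[𝕜] X) (S : ℝ → X →L[𝕜] X) (x : X) (t : ℝ) : X :=
  P (pval A (S t (Q (pval A (P x)))))

/-- The `n`-th term of the combinatorial expansion, applied to `x`:
`∑_{k ≤ n} (-1)^(n-k) / ((n-k)! k!) ∫_0^t P e^{(t-s)L} F n (P e^{sL} P)^k x ds`. -/
def expansionTerm (P : X →L[𝕜] X) (T : ℝ → X →L[𝕜] X) (F : ℕ → X →L[𝕜] X) (n : ℕ) (t : ℝ)
    (x : X) : X :=
  ∑ k ∈ Finset.range (n + 1), ((-1 : ℝ) ^ (n - k) / ((n - k)! * k !)) •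
    ∫ s in (0 : ℝ)..t, P (T (t - s) (F n (((P * T s * P) ^ k) x)))

/-- For every `x`, the Taylor series at `0` of `f x`, a function on `[0, ∞)`, converges to `f x`
on `[0, r)`. -/
def TaylorConverges (f : X → ℝ → X) (r : ℝ) : Prop :=
  ∀ x : X, ∀ t ∈ Ico 0 r,
    HasSum (fun m : ℕ => (t ^ m / (m ! : ℝ)) • iteratedDerivWithin m (f x) (Ici 0) 0) (f x t)

end MZ

end MoriZwanzig

end

namespace MoriZwanzig

/-! ### Strong continuity and differentiability of orbits. -/

section SemigroupLemmas

variable {𝕜 X : Type*} [RCLike 𝕜] [NormedAddCommGroup X] [NormedSpace 𝕜 X]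

/-! Write `w(s) = P e^{sL} P - P` and let `k` be the memory kernel. Since `a 1 = 0`, the Dyson
identity (`dyson`) says that the derivative of `P e^{tL} P x` is the integral over `[0, t]` of `P
e^{(t-s)L} k x s`. By the binomial theorem the `n`-th term of the expansion is the same integral
with `k x s` replaced by `(F n / n!) w(s)^n x` (`expansionTerm_eq`). So the task is to expand the
kernel in powers of `w`.

On the level of Taylor series, `w` corresponds to `W = ∑_{m ≥ 1} a m X^m / m!`. The Dyson identity
is a Volterra equation whose coefficients give `K = ∑ P̃ (m+2) X^m / m!` for the kernel
(`iteratedDerivWithin_kernel`). As `B̂ n k` is `n!/k!` times the coefficient of `X^n` in `W^k`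
(`bellII_eq_coeff_pow`), the word equation is the formal identity `K = ∑ (F n / n!) W^n`.

This identity is solved by repeated division. Because the odd `a i` vanish, `K` is even and `W = X^2
M` with `M` even and `M(0) = a 2 / 2` invertible in the corner ring of `P`. An even series minus its
constant coefficient is divisible by `X^2`, hence on the right by `W`, and the quotient is again
even (`quotient_eq_C_add`). The constant coefficients of the successive quotients are the `F n /
n!`. Uniqueness comes from the equations of even order `2n`: only `k ≤ n` contributes, and the last
term is `F n` times an invertible multiple of `a 2 ^ n`.

After `N` divisions the remainder is the `N`-th quotient times `W^N`, of order `X^(2N)`; the time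
integral gains one more power of `t`, which is (1). For (2), the coefficients of the `N`-th quotient
are bounded by `C ρ^N R^m` with `R` independent of `N` (`norm_coeff_quotient_le`), while `w(s)` is
`O(s)` in norm, so the remainder decays geometrically for small times.

All this takes place among bounded operators: the closed graph theorem bounds both `L^n P` and the
inverse of `a 2`. -/

theorem IsC0Semigroup.tendsto_nhdsGE {T : ℝ → X →L[𝕜] X} (hT : IsC0Semigroup T) (x : X) :
    Tendsto (fun s => T s x) (𝓝[≥] 0) (𝓝 x) := by
  rw [← Ioi_insert, nhdsWithin_insert, tendsto_sup]
  refine ⟨?_, hT.tendsto x⟩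
  rw [tendsto_pure_left]
  intro s hs
  simpa [hT.zero] using mem_of_mem_nhds hs

/-- Otherwise there are times tending to `0` along which the norms are unbounded although every
orbit converges, against the uniform boundedness principle. -/
theorem IsC0Semigroup.exists_norm_le_near_zero [CompleteSpace X] {T : ℝ → X →L[𝕜] X}
    (hT : IsC0Semigroup T) : ∃ δ > 0, ∃ M, ∀ t ∈ Icc (0 : ℝ) δ, ‖T t‖ ≤ M := by
  by_contra! h
  have hpos : ∀ n : ℕ, (0 : ℝ) < 1 / ((n : ℝ) + 1) := fun n => Nat.one_div_pos_of_nat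
  choose t ht hbig using fun n : ℕ => h (1 / ((n : ℝ) + 1)) (hpos n) n
  have ht0 : Tendsto t atTop (𝓝[≥] 0) := by
    refine tendsto_nhdsWithin_iff.2 ⟨squeeze_zero (fun n => (ht n).1) (fun n => (ht n).2)
      tendsto_one_div_add_atTop_nhds_zero_nat, Eventually.of_forall fun n => (ht n).1⟩
  have hbdd : ∀ x : X, ∃ C, ∀ n, ‖T (t n) x‖ ≤ C := by
    intro x
    obtain ⟨C, hC⟩ := ((hT.tendsto_nhdsGE x).comp ht0).norm.bddAbove_range
    exact ⟨C, fun n => hC ⟨n, rfl⟩⟩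
  obtain ⟨C, hC⟩ := banach_steinhaus hbdd
  obtain ⟨n, hn⟩ := exists_nat_gt C
  exact absurd (hbig n) (not_lt.2 ((hC n).trans hn.le))

theorem IsC0Semigroup.exists_norm_le [CompleteSpace X] {T : ℝ → X →L[𝕜] X}
    (hT : IsC0Semigroup T) (τ : ℝ) : ∃ M, 0 ≤ M ∧ ∀ t ∈ Icc (0 : ℝ) τ, ‖T t‖ ≤ M := by
  obtain ⟨δ, hδ, M, hM⟩ := hT.exists_norm_le_near_zero
  have hM0 : 0 ≤ M := (norm_nonneg _).trans (hM 0 ⟨le_rfl, hδ.le⟩)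
  have key : ∀ n : ℕ, ∃ C, 0 ≤ C ∧ ∀ t ∈ Icc (0 : ℝ) (n * δ), ‖T t‖ ≤ C := by
    intro n
    induction n with
    | zero => exact ⟨M, hM0, fun t ht => hM t ⟨ht.1, ht.2.trans (by simpa using hδ.le)⟩⟩
    | succ n ih =>
      obtain ⟨C, hC0, hC⟩ := ih
      refine ⟨max C (C * M), le_max_of_le_left hC0, fun t ht => ?_⟩
      rcases le_total t (n * δ) with h | h
      · exact (hC t ⟨ht.1, h⟩).trans (le_max_left _ _)
      · have h1 : T t = T (n * δ) * T (t - n * δ) := by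
          rw [← hT.add _ _ (by positivity) (by linarith)]; congr 1; ring
        refine le_trans ?_ (le_max_right _ _)
        rw [h1]
        refine (norm_mul_le _ _).trans ?_
        have h2 := ht.2
        push_cast at h2
        exact mul_le_mul (hC _ ⟨by positivity, le_rfl⟩) (hM _ ⟨by linarith, by linarith⟩)
          (norm_nonneg _) hC0
  obtain ⟨n, hn⟩ := exists_nat_gt (τ / δ)
  obtain ⟨C, hC0, hC⟩ := key n
  exact ⟨C, hC0, fun t ht => hC t ⟨ht.1, ht.2.trans ((div_lt_iff₀ hδ).1 hn).le⟩⟩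

theorem IsC0Semigroup.apply_sub_apply {T : ℝ → X →L[𝕜] X} (hT : IsC0Semigroup T) {s t : ℝ}
    (hs : 0 ≤ s) (hst : s ≤ t) (x : X) : T t x - T s x = T s (T (t - s) x - x) := by
  have : T t = T s * T (t - s) := by
    rw [← hT.add _ _ hs (by linarith)]; congr 1; ring
  rw [this, map_sub]; rfl

theorem IsC0Semigroup.norm_apply_sub_apply_le {T : ℝ → X →L[𝕜] X} (hT : IsC0Semigroup T)
    {s t M τ : ℝ} (hM : ∀ t ∈ Icc (0 : ℝ) τ, ‖T t‖ ≤ M) (hs : s ∈ Icc 0 τ) (ht : t ∈ Icc 0 τ)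
    (x : X) : ‖T t x - T s x‖ ≤ M * ‖T |t - s| x - x‖ := by
  rcases le_total s t with h | h
  · rw [hT.apply_sub_apply hs.1 h, abs_of_nonneg (by linarith)]
    exact (T s).le_of_opNorm_le (hM s hs) _
  · rw [norm_sub_rev, hT.apply_sub_apply ht.1 h, abs_sub_comm, abs_of_nonneg (by linarith)]
    exact (T t).le_of_opNorm_le (hM t ht) _

/-- Local boundedness of the norms upgrades strong continuity to joint continuity. The truncation
`max q.1 0` hides the arbitrary values at negative times. -/
theorem IsC0Semigroup.continuous_uncurry [CompleteSpace X] {T : ℝ → X →L[𝕜] X}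
    (hT : IsC0Semigroup T) : Continuous fun q : ℝ × X => T (max q.1 0) q.2 := by
  rw [continuous_iff_continuousAt]
  rintro ⟨t₀, x₀⟩
  obtain ⟨M, hM0, hM⟩ := hT.exists_norm_le (max t₀ 0 + 1)
  have hev : ∀ᶠ q : ℝ × X in 𝓝 (t₀, x₀), max q.1 0 ∈ Icc (0 : ℝ) (max t₀ 0 + 1) := by
    have h1 : Continuous fun q : ℝ × X => max q.1 0 := by fun_prop
    filter_upwards [h1.continuousAt.eventually_lt
      (continuousAt_const (y := max t₀ 0 + 1)) (by simp)] with q hq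
    exact ⟨le_max_right _ _, hq.le⟩
  rw [ContinuousAt, tendsto_iff_norm_sub_tendsto_zero]
  have hlim : Tendsto (fun q : ℝ × X => M * ‖q.2 - x₀‖ +
      M * ‖T |max q.1 0 - max t₀ 0| x₀ - x₀‖) (𝓝 (t₀, x₀)) (𝓝 0) := by
    have h1 : Tendsto (fun q : ℝ × X => M * ‖q.2 - x₀‖) (𝓝 (t₀, x₀)) (𝓝 0) := by
      have : Continuous fun q : ℝ × X => M * ‖q.2 - x₀‖ := by fun_prop
      simpa using this.tendsto (t₀, x₀)
    have h2 : Tendsto (fun q : ℝ × X => |max q.1 0 - max t₀ 0|) (𝓝 (t₀, x₀)) (𝓝[≥] 0) := by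
      refine tendsto_nhdsWithin_iff.2 ⟨?_, Eventually.of_forall fun q => mem_Ici.2 (abs_nonneg _)⟩
      have : Continuous fun q : ℝ × X => |max q.1 0 - max t₀ 0| := by fun_prop
      simpa using this.tendsto (t₀, x₀)
    have h3 := ((hT.tendsto_nhdsGE x₀).comp h2).sub_const x₀
    have h4 := (h3.norm.const_mul M)
    simpa using h1.add h4
  refine squeeze_zero' (Eventually.of_forall fun q => norm_nonneg _) ?_ hlim
  filter_upwards [hev] with q hq
  have h0 : max t₀ 0 ∈ Icc (0 : ℝ) (max t₀ 0 + 1) := ⟨le_max_right _ _, by linarith⟩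
  calc ‖T (max q.1 0) q.2 - T (max t₀ 0) x₀‖
      = ‖T (max q.1 0) (q.2 - x₀) + (T (max q.1 0) x₀ - T (max t₀ 0) x₀)‖ := by
        rw [map_sub]; congr 1; abel
    _ ≤ _ := (norm_add_le _ _).trans (add_le_add ((T _).le_of_opNorm_le (hM _ hq) _)
        (hT.norm_apply_sub_apply_le hM h0 hq x₀))

theorem IsC0Semigroup.tendsto_apply [CompleteSpace X] {T : ℝ → X →L[𝕜] X}
    (hT : IsC0Semigroup T) {ι : Type*} {l : Filter ι} {τ : ι → ℝ} {u : ι → X} {t : ℝ} {x : X}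
    (hτ : Tendsto τ l (𝓝 t)) (hτ0 : ∀ᶠ i in l, 0 ≤ τ i) (ht : 0 ≤ t) (hu : Tendsto u l (𝓝 x)) :
    Tendsto (fun i => T (τ i) (u i)) l (𝓝 (T t x)) := by
  have h := (hT.continuous_uncurry.tendsto (t, x)).comp (hτ.prodMk_nhds hu)
  simp only [max_eq_left ht] at h
  refine h.congr' ?_
  filter_upwards [hτ0] with i hi
  simp [hi]

theorem IsC0Semigroup.continuousOn_apply [CompleteSpace X] {T : ℝ → X →L[𝕜] X}
    (hT : IsC0Semigroup T) {s : Set ℝ} {τ : ℝ → ℝ} {u : ℝ → X} (hτ : ContinuousOn τ s)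
    (hτ0 : ∀ t ∈ s, 0 ≤ τ t) (hu : ContinuousOn u s) :
    ContinuousOn (fun t => T (τ t) (u t)) s := fun t ht =>
  hT.tendsto_apply (hτ t ht) (eventually_mem_nhdsWithin.mono hτ0) (hτ0 t ht) (hu t ht)

variable [NormedSpace ℝ X] [IsScalarTower ℝ 𝕜 X]

theorem Generates.apply_mem_graph {A : X →ₗ.[𝕜] X} {T : ℝ → X →L[𝕜] X} (hT : Generates A T)
    {x y : X} (hxy : (x, y) ∈ A.graph) {t : ℝ} (ht : 0 ≤ t) : (T t x, T t y) ∈ A.graph := by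
  rw [hT.2] at hxy ⊢
  refine (((T t).continuous.tendsto y).comp hxy).congr' ?_
  filter_upwards [self_mem_nhdsWithin] with h hh
  have h1 : T h (T t x) = T t (T h x) := by
    have := hT.1.add h t (le_of_lt hh) ht
    rw [add_comm, hT.1.add t h ht (le_of_lt hh)] at this
    exact (congrArg (fun B : X →L[𝕜] X => B x) this).symm
  simp only [Function.comp]
  rw [ContinuousLinearMap.map_smul_of_tower, map_sub, h1]

/-- On either side of `t` the slope is `T (min s t)` applied to the difference quotient at `0` with
step `|s - t|`, so joint continuity treats both one-sided limits at once. -/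
theorem Generates.hasDerivWithinAt [CompleteSpace X] {A : X →ₗ.[𝕜] X} {T : ℝ → X →L[𝕜] X}
    (hT : Generates A T) {x y : X} (hxy : (x, y) ∈ A.graph) {t : ℝ} (ht : 0 ≤ t) :
    HasDerivWithinAt (fun s => T s x) (T t y) (Ici 0) t := by
  rw [hT.2] at hxy
  rw [hasDerivWithinAt_iff_tendsto_slope]
  have habs : Tendsto (fun s => |s - t|) (𝓝[Ici 0 \ {t}] t) (𝓝[>] 0) := by
    refine tendsto_nhdsWithin_iff.2 ⟨?_, ?_⟩
    · have : Continuous fun s => |s - t| := by fun_prop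
      simpa using (this.tendsto t).mono_left nhdsWithin_le_nhds
    · filter_upwards [self_mem_nhdsWithin] with s hs
      exact abs_pos.2 (sub_ne_zero.2 hs.2)
  have hmin : Tendsto (fun s => min s t) (𝓝[Ici 0 \ {t}] t) (𝓝 t) := by
    have : Continuous fun s => min s t := by fun_prop
    simpa using (this.tendsto t).mono_left nhdsWithin_le_nhds
  have hmin0 : ∀ᶠ s in 𝓝[Ici 0 \ {t}] t, 0 ≤ min s t := by
    filter_upwards [self_mem_nhdsWithin] with s hs
    exact le_min hs.1 ht
  refine (hT.1.tendsto_apply hmin hmin0 ht (hxy.comp habs)).congr' ?_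
  filter_upwards [self_mem_nhdsWithin] with s hs
  simp only [Function.comp, slope_def_module]
  rw [ContinuousLinearMap.map_smul_of_tower]
  rcases le_total s t with h | h
  · rw [min_eq_left h, abs_sub_comm, abs_of_nonneg (by linarith), ← hT.1.apply_sub_apply hs.1 h,
      ← neg_sub s t, inv_neg, neg_smul, ← smul_neg, neg_sub]
  · rw [min_eq_right h, abs_of_nonneg (by linarith), ← hT.1.apply_sub_apply ht h]

/-- Product rule: the slope is `T (t - σ)` applied to the slope of `u`, plus the slope of the orbit
of the fixed vector `u s`. Only the second part involves the generator, so a domain condition is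
needed at `s` alone. -/
theorem Generates.hasDerivWithinAt_apply_sub [CompleteSpace X] {A : X →ₗ.[𝕜] X}
    {T : ℝ → X →L[𝕜] X} (hT : Generates A T) {u : ℝ → X} {u' v : X} {s t : ℝ}
    (hs : s ∈ Icc 0 t) (hu : HasDerivWithinAt u u' (Icc 0 t) s) (hv : (u s, v) ∈ A.graph) :
    HasDerivWithinAt (fun σ => T (t - σ) (u σ)) (T (t - s) (u' - v)) (Icc 0 t) s := by
  have h2 : HasDerivWithinAt (fun σ => T (t - σ) (u s)) (-T (t - s) v) (Icc 0 t) s := by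
    have h1 : HasDerivWithinAt (fun σ : ℝ => t - σ) (-1) (Icc 0 t) s := by
      simpa using (hasDerivWithinAt_id s (Icc 0 t)).const_sub t
    have := HasDerivWithinAt.scomp (t' := Ici 0) s
      (hT.hasDerivWithinAt hv (t := t - s) (by linarith [hs.2])) h1 (fun σ hσ => by simpa using hσ.2)
    simpa [Function.comp_def] using this
  rw [map_sub, sub_eq_add_neg]
  rw [hasDerivWithinAt_iff_tendsto_slope] at hu h2 ⊢
  have h1 : Tendsto (fun σ => T (t - σ) (slope u s σ)) (𝓝[Icc 0 t \ {s}] s)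
      (𝓝 (T (t - s) u')) := by
    refine hT.1.tendsto_apply ?_ ?_ (by linarith [hs.2]) hu
    · have : Continuous fun σ => t - σ := by fun_prop
      exact (this.tendsto s).mono_left nhdsWithin_le_nhds
    · filter_upwards [self_mem_nhdsWithin] with σ hσ
      linarith [hσ.1.2]
  refine (h1.add h2).congr fun σ => ?_
  simp only [slope_def_module]
  rw [ContinuousLinearMap.map_smul_of_tower, ← smul_add, map_sub]
  congr 1
  abel

end SemigroupLemmas

/-! ### Asymptotic expansions as `t → 0+`. -/

section Asymptotics

theorem isBigO_nhdsGE_pow_iff {E : Type*} [NormedAddCommGroup E] {f : ℝ → E} {M : ℕ} :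
    f =O[𝓝[≥] 0] (fun t : ℝ => t ^ M) ↔
      ∃ ε > 0, ∃ C, 0 ≤ C ∧ ∀ t ∈ Icc (0 : ℝ) ε, ‖f t‖ ≤ C * t ^ M := by
  constructor
  · intro h
    obtain ⟨C, hC0, hC⟩ := h.exists_nonneg
    obtain ⟨ε, hε, h2⟩ := mem_nhdsGE_iff_exists_Icc_subset.1 hC.bound
    refine ⟨ε, hε, C, hC0, fun t ht => ?_⟩
    have := h2 ht
    simpa [abs_of_nonneg ht.1] using this
  · rintro ⟨ε, hε, C, -, h⟩
    refine Asymptotics.IsBigO.of_bound C ?_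
    filter_upwards [Icc_mem_nhdsGE hε] with t ht
    simpa [abs_of_nonneg ht.1] using h t ht

theorem isBigO_pow_nhdsGE {m n : ℕ} (h : m ≤ n) :
    (fun t : ℝ => t ^ n) =O[𝓝[≥] 0] (fun t : ℝ => t ^ m) := by
  refine Asymptotics.IsBigO.of_bound 1 ?_
  filter_upwards [Icc_mem_nhdsGE (zero_lt_one' ℝ)] with t ht
  simpa [abs_of_nonneg ht.1] using pow_le_pow_of_le_one ht.1 ht.2 h

theorem isBigO_integral_nhdsGE {E : Type*} [NormedAddCommGroup E] [NormedSpace ℝ E]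
    {g : ℝ → ℝ → E} {M : ℕ} {ε C : ℝ} (hε : 0 < ε)
    (h : ∀ t ≤ ε, ∀ s ∈ Icc 0 t, ‖g t s‖ ≤ C * t ^ M) :
    (fun t => ∫ s in (0 : ℝ)..t, g t s) =O[𝓝[≥] 0] (fun t : ℝ => t ^ (M + 1)) := by
  refine Asymptotics.IsBigO.of_bound C ?_
  filter_upwards [Icc_mem_nhdsGE hε] with t ht
  refine (intervalIntegral.norm_integral_le_of_norm_le_const (C := C * t ^ M) ?_).trans ?_
  · intro s hs
    rw [uIoc_of_le ht.1] at hs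
    exact h t ht.2 s ⟨hs.1.le, hs.2⟩
  · rw [sub_zero, norm_pow, Real.norm_eq_abs, abs_of_nonneg ht.1, pow_succ, mul_assoc]

theorem sum_antidiagonal_range {E : Type*} [AddCommMonoid E] (F : ℕ → ℕ → E) (M : ℕ) :
    ∑ n ∈ Finset.range M, ∑ q ∈ Finset.HasAntidiagonal.antidiagonal n, F q.1 q.2 =
      ∑ i ∈ Finset.range M, ∑ j ∈ Finset.range (M - i), F i j := by
  induction M with
  | zero => simp
  | succ M ih =>
    rw [Finset.sum_range_succ, ih, Finset.Nat.sum_antidiagonal_eq_sum_range_succ F,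
      Finset.sum_range_succ _ M, Finset.sum_range_succ _ M, ← add_assoc,
      ← Finset.sum_add_distrib]
    congr 1
    · refine Finset.sum_congr rfl fun i hi => ?_
      have : M + 1 - i = M - i + 1 := by have := Finset.mem_range.1 hi; omega
      rw [this, Finset.sum_range_succ]
    · simp

variable (𝕜 : Type*) [RCLike 𝕜] {E : Type*} [NormedAddCommGroup E] [NormedSpace 𝕜 E]

/-- The function `f` has the asymptotic expansion `∑ t ^ m • c m` as `t → 0+`. -/
def HasExpansion (f : ℝ → E) (c : ℕ → E) : Prop :=
  ∀ M, (fun t => f t - ∑ m ∈ Finset.range M, (t : 𝕜) ^ m • c m) =O[𝓝[≥] 0] fun t : ℝ => t ^ M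

variable {𝕜}

theorem isBigO_coe_pow_smul (m : ℕ) (c : E) :
    (fun t : ℝ => (t : 𝕜) ^ m • c) =O[𝓝[≥] 0] fun t : ℝ => t ^ m := by
  refine Asymptotics.IsBigO.of_bound ‖c‖ (Eventually.of_forall fun t => ?_)
  rw [norm_smul, norm_pow, RCLike.norm_ofReal, norm_pow, Real.norm_eq_abs, mul_comm]

/-- Once the lower coefficients vanish, the monomial of degree `n` is `O(t^(n+1))`; dividing by
`t^n` leaves `‖d n‖ ≤ C t`. -/
theorem coeff_eq_zero_of_isBigO {d : ℕ → E} {M : ℕ}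
    (h : (fun t : ℝ => ∑ m ∈ Finset.range M, (t : 𝕜) ^ m • d m) =O[𝓝[≥] 0] fun t : ℝ => t ^ M) :
    ∀ m < M, d m = 0 := by
  intro m
  induction m using Nat.strong_induction_on with
  | _ n ih =>
    intro hn
    have h1 : (fun t : ℝ => (t : 𝕜) ^ n • d n) =O[𝓝[≥] 0] fun t : ℝ => t ^ (n + 1) := by
      have h2 : (fun t : ℝ => ∑ m ∈ (Finset.range M).erase n, (t : 𝕜) ^ m • d m)
          =O[𝓝[≥] 0] fun t : ℝ => t ^ (n + 1) := by
        refine Asymptotics.IsBigO.fun_sum fun m hm => ?_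
        obtain ⟨hmn, hmM⟩ := Finset.mem_erase.1 hm
        rcases lt_or_gt_of_ne hmn with h3 | h3
        · simp only [ih m h3 (Finset.mem_range.1 hmM), smul_zero]
          exact Asymptotics.isBigO_zero (E' := E) _ _
        · exact (isBigO_coe_pow_smul m _).trans (isBigO_pow_nhdsGE h3)
      refine ((h.trans (isBigO_pow_nhdsGE (m := n + 1) hn)).sub h2).congr_left fun t => ?_
      rw [← Finset.sum_erase_add _ _ (Finset.mem_range.2 hn), add_sub_cancel_left]
    obtain ⟨ε, hε, C, hC, h2⟩ := isBigO_nhdsGE_pow_iff.1 h1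
    have h3 : ∀ᶠ t in 𝓝[>] (0 : ℝ), ‖d n‖ ≤ C * t := by
      filter_upwards [Ioc_mem_nhdsGT hε] with t ht
      have h4 := h2 t ⟨ht.1.le, ht.2⟩
      rw [norm_smul, norm_pow, RCLike.norm_ofReal, abs_of_pos ht.1, pow_succ] at h4
      have h5 : 0 < t ^ n := pow_pos ht.1 n
      refine le_of_mul_le_mul_left ?_ h5
      linarith
    have h4 : Tendsto (fun t : ℝ => C * t) (𝓝[>] 0) (𝓝 0) := by
      have : Continuous fun t : ℝ => C * t := by fun_prop
      simpa using (this.tendsto 0).mono_left nhdsWithin_le_nhds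
    exact norm_le_zero_iff.1 (ge_of_tendsto h4 h3)

theorem HasExpansion.unique {f : ℝ → E} {c c' : ℕ → E} (h : HasExpansion 𝕜 f c)
    (h' : HasExpansion 𝕜 f c') : c = c' := by
  funext m
  have h1 := coeff_eq_zero_of_isBigO (𝕜 := 𝕜) (d := c - c') (M := m + 1)
    (((h' (m + 1)).sub (h (m + 1))).congr_left fun t => by
      simp [smul_sub, Finset.sum_sub_distrib]) m (Nat.lt_succ_self m)
  exact sub_eq_zero.1 h1

theorem HasExpansion.congr {f g : ℝ → E} {c : ℕ → E} (h : HasExpansion 𝕜 f c)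
    (hfg : ∀ t, 0 ≤ t → f t = g t) : HasExpansion 𝕜 g c := fun M =>
  (h M).congr' (by filter_upwards [self_mem_nhdsWithin] with t ht; rw [hfg t ht])
    EventuallyEq.rfl

theorem HasExpansion.sub {f g : ℝ → E} {c d : ℕ → E} (hf : HasExpansion 𝕜 f c)
    (hg : HasExpansion 𝕜 g d) : HasExpansion 𝕜 (fun t => f t - g t) (fun m => c m - d m) :=
  fun M => ((hf M).sub (hg M)).congr_left fun t => by
    simp only [smul_sub, Finset.sum_sub_distrib]; abel

theorem HasExpansion.sum {ι : Type*} (s : Finset ι) {f : ι → ℝ → E} {c : ι → ℕ → E}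
    (h : ∀ i ∈ s, HasExpansion 𝕜 (f i) (c i)) :
    HasExpansion 𝕜 (fun t => ∑ i ∈ s, f i t) (fun m => ∑ i ∈ s, c i m) :=
  fun M => (Asymptotics.IsBigO.fun_sum fun i hi => h i hi M).congr_left fun t => by
    simp only [Finset.smul_sum, Finset.sum_sub_distrib]
    rw [Finset.sum_comm]

theorem HasExpansion.clm {F : Type*} [NormedAddCommGroup F] [NormedSpace 𝕜 F] (A : E →L[𝕜] F)
    {f : ℝ → E} {c : ℕ → E} (h : HasExpansion 𝕜 f c) :
    HasExpansion 𝕜 (fun t => A (f t)) (fun m => A (c m)) :=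
  fun M => ((A.isBigO_comp _ _).trans (h M)).congr_left fun t => by simp

theorem hasExpansion_const (c : E) : HasExpansion 𝕜 (fun _ => c) (fun m => if m = 0 then c else 0) := by
  intro M
  rcases M with _ | M
  · simpa using Asymptotics.isBigO_const_const c (one_ne_zero (α := ℝ)) (𝓝[≥] (0 : ℝ))
  · refine (Asymptotics.isBigO_zero _ _).congr_left fun t => ?_
    rw [Finset.sum_range_succ']
    simp

/-- The error is `(f - f_M) g` plus the sum of `t^i A_i (g - g_{M-i})`, where `f_M` and `g_{M-i}`
are truncations. Cutting `g` at `M - i` makes every summand `O(t^M)` and leaves exactly the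
truncated Cauchy product. -/
theorem HasExpansion.mul {R : Type*} [NormedRing R] [NormedAlgebra 𝕜 R] {f g : ℝ → R}
    {A B : PowerSeries R} (hf : HasExpansion 𝕜 f fun m => PowerSeries.coeff m A)
    (hg : HasExpansion 𝕜 g fun m => PowerSeries.coeff m B) :
    HasExpansion 𝕜 (fun t => f t * g t) fun m => PowerSeries.coeff m (A * B) := by
  intro M
  have hg0 : g =O[𝓝[≥] 0] (fun _ => (1 : ℝ)) := by simpa using hg 0
  have h1 : (fun t => (f t - ∑ m ∈ Finset.range M, (t : 𝕜) ^ m • PowerSeries.coeff m A) * g t)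
      =O[𝓝[≥] 0] fun t : ℝ => t ^ M := by
    simpa using (hf M).mul hg0
  have h2 : (fun t : ℝ => ∑ i ∈ Finset.range M, ((t : 𝕜) ^ i • PowerSeries.coeff i A) *
      (g t - ∑ j ∈ Finset.range (M - i), (t : 𝕜) ^ j • PowerSeries.coeff j B))
      =O[𝓝[≥] 0] fun t : ℝ => t ^ M := by
    refine Asymptotics.IsBigO.fun_sum fun i hi => ?_
    refine ((isBigO_coe_pow_smul i _).mul (hg (M - i))).congr_right fun t => ?_
    rw [← pow_add]
    congr 1
    have := Finset.mem_range.1 hi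
    omega
  refine (h1.add h2).congr_left fun t => ?_
  have h3 : ∑ m ∈ Finset.range M, (t : 𝕜) ^ m • PowerSeries.coeff m (A * B) =
      ∑ i ∈ Finset.range M, ((t : 𝕜) ^ i • PowerSeries.coeff i A) *
        ∑ j ∈ Finset.range (M - i), (t : 𝕜) ^ j • PowerSeries.coeff j B := by
    simp only [Finset.mul_sum]
    rw [← sum_antidiagonal_range (fun i j => ((t : 𝕜) ^ i • PowerSeries.coeff i A) *
      ((t : 𝕜) ^ j • PowerSeries.coeff j B))]
    refine Finset.sum_congr rfl fun n _ => ?_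
    rw [PowerSeries.coeff_mul, Finset.smul_sum]
    refine Finset.sum_congr rfl fun q hq => ?_
    rw [smul_mul_smul_comm, ← pow_add, Finset.HasAntidiagonal.mem_antidiagonal.1 hq]
  rw [h3]
  simp only [mul_sub, Finset.sum_sub_distrib, ← Finset.sum_mul, sub_mul]
  abel

theorem HasExpansion.pow {R : Type*} [NormedRing R] [NormedAlgebra 𝕜 R] {f : ℝ → R}
    {A : PowerSeries R} (hf : HasExpansion 𝕜 f fun m => PowerSeries.coeff m A) (n : ℕ) :
    HasExpansion 𝕜 (fun t => f t ^ n) fun m => PowerSeries.coeff m (A ^ n) := by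
  induction n with
  | zero =>
    simp only [pow_zero, PowerSeries.coeff_one]
    exact hasExpansion_const 1
  | succ n ih => simpa only [pow_succ] using ih.mul hf

/-- Taylor's formula is used at order `M`, where its error is `o(t^M)`; the term of degree `M`
itself is then moved into the error. -/
theorem hasExpansion_of_contDiffOn [NormedSpace ℝ E] [IsScalarTower ℝ 𝕜 E] {f : ℝ → E}
    (hf : ContDiffOn ℝ ∞ f (Ici 0)) :
    HasExpansion 𝕜 f fun m => (m ! : 𝕜)⁻¹ • iteratedDerivWithin m f (Ici 0) 0 := by
  intro M
  have h1 := taylor_isLittleO (n := M) (convex_Ici (0 : ℝ)) self_mem_Ici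
    (hf.of_le (by exact_mod_cast le_top))
  have h2 := isBigO_coe_pow_smul (𝕜 := 𝕜) M ((M ! : 𝕜)⁻¹ • iteratedDerivWithin M f (Ici 0) 0)
  simp only [sub_zero] at h1
  refine (h1.isBigO.add h2).congr_left fun t => ?_
  have h3 : taylorWithinEval f M (Ici 0) 0 t = ∑ m ∈ Finset.range (M + 1),
      (t : 𝕜) ^ m • (m ! : 𝕜)⁻¹ • iteratedDerivWithin m f (Ici 0) 0 := by
    rw [taylor_within_apply]
    refine Finset.sum_congr rfl fun m _ => ?_
    rw [RCLike.real_smul_eq_coe_smul (K := 𝕜), smul_smul]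
    congr 1
    push_cast
    rw [sub_zero, mul_comm]
  rw [h3, Finset.sum_range_succ]
  abel

/-- A Beta integral; integration by parts trades one power of `t - s` for one of `s`. -/
theorem integral_sub_pow_mul_pow (t : ℝ) (i j : ℕ) :
    ∫ s in (0 : ℝ)..t, ((t - s) ^ i / (i ! : ℝ)) * (s ^ j / (j ! : ℝ)) =
      t ^ (i + j + 1) / ((i + j + 1)! : ℝ) := by
  induction i generalizing j with
  | zero =>
    simp only [pow_zero, Nat.factorial_zero, Nat.cast_one, div_one, one_mul, zero_add,
      intervalIntegral.integral_div, integral_pow, Nat.factorial_succ]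
    push_cast
    have : (j ! : ℝ) ≠ 0 := by positivity
    have : (j : ℝ) + 1 ≠ 0 := by positivity
    field_simp
    simp
  | succ i ih =>
    have hd : ∀ s ∈ uIcc 0 t, HasDerivAt
        (fun s : ℝ => ((t - s) ^ (i + 1) / ((i + 1)! : ℝ)) * (s ^ (j + 1) / ((j + 1)! : ℝ)))
        (((t - s) ^ (i + 1) / ((i + 1)! : ℝ)) * (s ^ j / (j ! : ℝ)) -
          ((t - s) ^ i / (i ! : ℝ)) * (s ^ (j + 1) / ((j + 1)! : ℝ))) s := by
      intro s _
      have h1 : HasDerivAt (fun s : ℝ => (t - s) ^ (i + 1) / ((i + 1)! : ℝ))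
          (-((t - s) ^ i / (i ! : ℝ))) s := by
        refine ((((hasDerivAt_id' s).const_sub t).fun_pow (i + 1)).div_const
          ((i + 1)! : ℝ)).congr_deriv ?_
        simp only [Nat.factorial_succ, Nat.add_sub_cancel]
        push_cast
        have : (i ! : ℝ) ≠ 0 := by positivity
        have : (i : ℝ) + 1 ≠ 0 := by positivity
        field_simp
      have h2 : HasDerivAt (fun s : ℝ => s ^ (j + 1) / ((j + 1)! : ℝ)) (s ^ j / (j ! : ℝ)) s := by
        refine (((hasDerivAt_id' s).fun_pow (j + 1)).div_const
          ((j + 1)! : ℝ)).congr_deriv ?_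
        simp only [Nat.factorial_succ, Nat.add_sub_cancel]
        push_cast
        have : (j ! : ℝ) ≠ 0 := by positivity
        have : (j : ℝ) + 1 ≠ 0 := by positivity
        field_simp
      exact (h1.mul h2).congr_deriv (by ring)
    have hi := intervalIntegral.integral_eq_sub_of_hasDerivAt hd
      (Continuous.intervalIntegrable (by fun_prop) _ _)
    rw [intervalIntegral.integral_sub (Continuous.intervalIntegrable (by fun_prop) _ _)
      (Continuous.intervalIntegrable (by fun_prop) _ _), ih (j + 1)] at hi
    have h0 : i + 1 + j + 1 = i + (j + 1) + 1 := by ring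
    rw [h0]
    simp only [sub_self, zero_pow (Nat.succ_ne_zero _), zero_div, zero_mul, mul_zero] at hi
    linarith

end Asymptotics

/-! ### Bell polynomials as coefficients of powers. -/

section Words

/-- The words of `k` positive letters whose sum is `n`. -/
def positiveWords : ℕ → ℕ → Finset (List ℕ)
  | n, 0 => if n = 0 then {[]} else ∅
  | n, k + 1 => ((Finset.HasAntidiagonal.antidiagonal n).filter fun q => 0 < q.1).biUnion fun q =>
      (positiveWords q.2 k).image fun l => q.1 :: l

theorem mem_positiveWords {n k : ℕ} {l : List ℕ} :
    l ∈ positiveWords n k ↔ l.length = k ∧ l.sum = n ∧ ∀ i ∈ l, 0 < i := by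
  induction k generalizing n l with
  | zero =>
    rw [positiveWords, List.length_eq_zero_iff]
    split_ifs with h
    · subst h
      constructor
      · intro h; rw [Finset.mem_singleton.1 h]; simp
      · intro h; simp [h.1]
    · constructor
      · intro h; simp at h
      · rintro ⟨rfl, h2, -⟩; exact absurd h2.symm (by simpa using h)
  | succ k ih =>
    rw [positiveWords]
    simp only [Finset.mem_biUnion, Finset.mem_filter, Finset.HasAntidiagonal.mem_antidiagonal,
      Finset.mem_image, ih]
    constructor
    · rintro ⟨q, ⟨hq, hq0⟩, l', ⟨h1, h2, h3⟩, rfl⟩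
      refine ⟨by simp [h1], by simp [h2, hq], ?_⟩
      intro i hi
      rcases List.mem_cons.1 hi with rfl | hi
      · exact hq0
      · exact h3 i hi
    · rintro ⟨h1, h2, h3⟩
      cases l with
      | nil => simp at h1
      | cons i l =>
        exact ⟨(i, l.sum), ⟨by simpa using h2, h3 i (by simp)⟩, l,
          ⟨by simpa using h1, rfl, fun j hj => h3 j (by simp [hj])⟩, rfl⟩

variable {R : Type*} [Ring R]

/-- Expanding the power gives all words of `k` letters with sum `n`; a letter `0` contributes the
vanishing constant coefficient. -/
theorem coeff_pow_eq_sum_positiveWords {A : PowerSeries R} (hA : PowerSeries.coeff 0 A = 0)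
    (n k : ℕ) : PowerSeries.coeff n (A ^ k) =
      ∑ l ∈ positiveWords n k, (l.map fun i => PowerSeries.coeff i A).prod := by
  induction k generalizing n with
  | zero =>
    rw [pow_zero, PowerSeries.coeff_one, positiveWords]
    split_ifs <;> simp
  | succ k ih =>
    rw [pow_succ', PowerSeries.coeff_mul, positiveWords, Finset.sum_biUnion]
    · rw [Finset.sum_filter]
      refine Finset.sum_congr rfl fun q _ => ?_
      split_ifs with h
      · rw [Finset.sum_image fun l _ l' _ h => (List.cons.inj h).2, ih, Finset.mul_sum]
        simp
      · rw [Nat.eq_zero_of_not_pos h, hA, zero_mul]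
    · intro q hq q' hq' hne
      rw [Function.onFun, Finset.disjoint_left]
      intro l hl hl'
      obtain ⟨l₁, h1, rfl⟩ := Finset.mem_image.1 hl
      obtain ⟨l₂, h2, h3⟩ := Finset.mem_image.1 hl'
      have h4 := (List.cons.inj h3).1
      have h5 := (Finset.mem_filter.1 hq).1
      have h6 := (Finset.mem_filter.1 hq').1
      rw [Finset.HasAntidiagonal.mem_antidiagonal] at h5 h6
      exact hne (Prod.ext h4.symm (by omega))

theorem sum_composition_eq_sum_positiveWords {E : Type*} [AddCommMonoid E] (f : List ℕ → E)
    (n k : ℕ) : ∑ c : Composition n with c.length = k, f c.blocks =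
      ∑ l ∈ positiveWords n k, f l := by
  refine Finset.sum_bij (fun c _ => c.blocks) ?_ ?_ ?_ ?_
  · intro c hc
    exact mem_positiveWords.2 ⟨(Finset.mem_filter.1 hc).2, c.blocks_sum,
      fun i hi => c.blocks_pos hi⟩
  · intro c _ c' _ h
    exact Composition.ext h
  · intro l hl
    obtain ⟨h1, h2, h3⟩ := mem_positiveWords.1 hl
    exact ⟨⟨l, fun {i} hi => h3 i hi, h2⟩, by simpa [Composition.length] using h1, rfl⟩
  · intro c _
    rfl

variable {𝕜 : Type*} [RCLike 𝕜] [Algebra 𝕜 R]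

variable (𝕜) in
/-- The exponential generating series `∑_{m ≥ 1} a m * X ^ m / m!`. -/
noncomputable def expSeries (a : ℕ → R) : PowerSeries R :=
  PowerSeries.mk fun m => if m = 0 then 0 else (m ! : 𝕜)⁻¹ • a m

/-- The weights `1 / j!` are scalars and are absorbed letter by letter into the exponential series,
while the order of the noncommuting factors is kept. -/
theorem bellII_eq_coeff_pow (a : ℕ → R) (n k : ℕ) :
    bellII 𝕜 a n k = ((n ! : 𝕜) / (k ! : 𝕜)) • PowerSeries.coeff n (expSeries 𝕜 a ^ k) := by
  have h0 : PowerSeries.coeff 0 (expSeries 𝕜 a) = 0 := by simp [expSeries]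
  rw [coeff_pow_eq_sum_positiveWords h0, ← sum_composition_eq_sum_positiveWords
    (fun l => (l.map fun i => PowerSeries.coeff i (expSeries 𝕜 a)).prod), bellII,
    Finset.smul_sum]
  refine Finset.sum_congr rfl fun c _ => ?_
  have key : ∀ l : List ℕ, (∀ i ∈ l, 0 < i) →
      (l.map fun i => PowerSeries.coeff i (expSeries 𝕜 a)).prod =
        (((l.map Nat.factorial).prod : ℕ) : 𝕜)⁻¹ • (l.map a).prod := by
    intro l
    induction l with
    | nil => simp
    | cons i l ih =>
      intro hl
      have hi : i ≠ 0 := (hl i (by simp)).ne'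
      rw [List.map_cons, List.prod_cons, ih fun j hj => hl j (by simp [hj])]
      simp only [expSeries, PowerSeries.coeff_mk, if_neg hi, List.map_cons, List.prod_cons]
      rw [smul_mul_smul_comm]
      push_cast
      rw [mul_inv]
  rw [key _ fun i hi => c.blocks_pos hi, smul_smul]
  congr 1
  ring

end Words

/-! ### Recursion and parity of the bipartition polynomials. -/

section Bipartition

variable {R : Type*} [Ring R]

/-- The sign is positive for `k = 0` only. This is the form in which the recursion meets the
Volterra equation of the kernel. -/
theorem bipartition_succ (a : ℕ → R) (n : ℕ) : bipartition a (n + 1) =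
    a (n + 1) - ∑ k ∈ Finset.range n, a (n - k) * bipartition a (k + 1) := by
  rw [bipartition, Fin.sum_univ_eq_sum_range
    (fun k => (-1) ^ ((if k = 0 then 1 else 0) + 1) * a (n + 1 - k) * bipartition a k) (n + 1),
    Finset.sum_range_succ', add_comm, sub_eq_add_neg, ← Finset.sum_neg_distrib]
  congr 1
  · simp [bipartition]
  · refine Finset.sum_congr rfl fun k _ => ?_
    simp

theorem bipartition_mul {a : ℕ → R} {P : R} (ha : ∀ n, a n * P = a n) (n : ℕ) :
    bipartition a (n + 1) * P = bipartition a (n + 1) := by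
  induction n using Nat.strong_induction_on with
  | _ n ih =>
    rw [bipartition_succ, sub_mul, ha, Finset.sum_mul]
    congr 1
    refine Finset.sum_congr rfl fun k hk => ?_
    rw [mul_assoc, ih k (Finset.mem_range.1 hk)]

/-- In each product of the recursion the two indices add up to the odd order, so one of them is odd.
-/
theorem bipartition_odd {a : ℕ → R} (ha : ∀ k, a (2 * k + 1) = 0) (n : ℕ) (hn : Odd n) :
    bipartition a n = 0 := by
  induction n using Nat.strong_induction_on with
  | _ n ih =>
    obtain ⟨m, rfl⟩ := hn
    rw [bipartition_succ, ha, zero_sub, neg_eq_zero]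
    refine Finset.sum_eq_zero fun k hk => ?_
    have hk' := Finset.mem_range.1 hk
    rcases Nat.even_or_odd k with h | h
    · rw [ih (k + 1) (by omega) h.add_one, mul_zero]
    · obtain ⟨j, rfl⟩ := h
      have : 2 * m - (2 * j + 1) = 2 * (m - j - 1) + 1 := by omega
      rw [this, ha, zero_mul]

theorem map_bipartition {S : Type*} [Ring S] (f : R →+* S) (a : ℕ → R) (n : ℕ) :
    bipartition (fun i => f (a i)) n = f (bipartition a n) := by
  induction n using Nat.strong_induction_on with
  | _ n ih =>
    cases n with
    | zero => simp [bipartition]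
    | succ n =>
      rw [bipartition_succ, bipartition_succ, map_sub, map_sum]
      congr 1
      refine Finset.sum_congr rfl fun k hk => ?_
      rw [map_mul, ih _ (by have := Finset.mem_range.1 hk; omega)]

theorem map_bellII {𝕜 : Type*} [Field 𝕜] [Algebra 𝕜 R] {S : Type*} [Ring S] [Algebra 𝕜 S]
    (f : R →ₐ[𝕜] S) (a : ℕ → R) (n k : ℕ) :
    bellII 𝕜 (fun i => f (a i)) n k = f (bellII 𝕜 a n k) := by
  simp only [bellII, map_sum, map_smul, map_list_prod, List.map_map]
  rfl

end Bipartition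

/-! ### Right division of even series by a series of order two. -/

section Division

variable {R : Type*} [Ring R]

/-- All coefficients of odd order vanish. -/
def IsEvenSeries (A : PowerSeries R) : Prop :=
  ∀ n, Odd n → PowerSeries.coeff n A = 0

theorem IsEvenSeries.mul {A B : PowerSeries R} (hA : IsEvenSeries A) (hB : IsEvenSeries B) :
    IsEvenSeries (A * B) := by
  intro n hn
  rw [PowerSeries.coeff_mul]
  refine Finset.sum_eq_zero fun q hq => ?_
  rw [Finset.HasAntidiagonal.mem_antidiagonal] at hq
  rcases Nat.even_or_odd q.1 with h | h
  · rw [hB q.2, mul_zero]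
    rw [← hq] at hn
    exact (Nat.odd_add'.1 hn).2 h
  · rw [hA _ h, zero_mul]

theorem isEvenSeries_C (x : R) : IsEvenSeries (PowerSeries.C x) := by
  intro n hn
  rw [PowerSeries.coeff_C, if_neg]
  rintro rfl
  simp at hn

theorem IsEvenSeries.invOfUnit {A : PowerSeries R} (hA : IsEvenSeries A) (u : Rˣ) :
    IsEvenSeries (PowerSeries.invOfUnit A u) := by
  intro n
  induction n using Nat.strong_induction_on with
  | _ n ih =>
    intro hn
    have h0 : n ≠ 0 := by rintro rfl; simp at hn
    rw [PowerSeries.coeff_invOfUnit, if_neg h0, Finset.sum_eq_zero, mul_zero]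
    intro q hq
    rw [Finset.HasAntidiagonal.mem_antidiagonal] at hq
    split_ifs with hlt
    · rcases Nat.even_or_odd q.1 with h | h
      · rw [ih q.2 hlt, mul_zero]
        rw [← hq] at hn
        exact (Nat.odd_add'.1 hn).2 h
      · rw [hA _ h, zero_mul]
    · rfl

/-- The series `(A - A 0 - A 1 * X) / X ^ 2`. -/
noncomputable def shiftTwo (A : PowerSeries R) : PowerSeries R :=
  PowerSeries.mk fun m => PowerSeries.coeff (m + 2) A

/-- Repeated right division of `K` by a series `w = X ^ 2 * μ`, where `E` is the inverse of `μ`. -/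
noncomputable def quotient (E K : PowerSeries R) : ℕ → PowerSeries R
  | 0 => K
  | n + 1 => shiftTwo (quotient E K n) * E

variable {P : R} {E K M : PowerSeries R}

theorem quotient_isEven (hE : IsEvenSeries E) (hK : IsEvenSeries K) (n : ℕ) :
    IsEvenSeries (quotient E K n) := by
  induction n with
  | zero => exact hK
  | succ n ih =>
    refine IsEvenSeries.mul (fun m hm => ?_) hE
    rw [shiftTwo, PowerSeries.coeff_mk]
    exact ih _ (hm.add_even (by decide))

theorem quotient_mul_C (hEP : E * PowerSeries.C P = E) (hKP : K * PowerSeries.C P = K) (n : ℕ) :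
    quotient E K n * PowerSeries.C P = quotient E K n := by
  cases n with
  | zero => exact hKP
  | succ n => rw [quotient, mul_assoc, hEP]

/-- Evenness kills the coefficient of `X`, so the constant coefficient is the only obstruction to
dividing by `X^2`. Multiplying by `E` and then by `M` amounts to multiplying by `P`, which the
series absorbs on the right. -/
theorem quotient_eq_C_add (hE : IsEvenSeries E) (hK : IsEvenSeries K)
    (hEP : E * PowerSeries.C P = E) (hKP : K * PowerSeries.C P = K)
    (hEM : E * M = PowerSeries.C P) (n : ℕ) :
    quotient E K n = PowerSeries.C (PowerSeries.coeff 0 (quotient E K n)) +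
      quotient E K (n + 1) * (PowerSeries.X ^ 2 * M) := by
  have h1 : quotient E K (n + 1) * (PowerSeries.X ^ 2 * M) =
      PowerSeries.X ^ 2 * shiftTwo (quotient E K n) := by
    rw [← mul_assoc, ← PowerSeries.X_pow_mul, mul_assoc, quotient, mul_assoc, hEM]
    congr 1
    ext m
    have := congrArg (PowerSeries.coeff (m + 2)) (quotient_mul_C (P := P) hEP hKP n)
    simpa [shiftTwo] using this
  rw [h1]
  ext m
  rw [map_add, PowerSeries.coeff_C, PowerSeries.coeff_X_pow_mul']
  rcases m with _ | _ | m
  · simp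
  · simp [quotient_isEven hE hK n 1 odd_one]
  · simp [shiftTwo]

theorem eq_sum_quotient (hE : IsEvenSeries E) (hK : IsEvenSeries K)
    (hEP : E * PowerSeries.C P = E) (hKP : K * PowerSeries.C P = K)
    (hEM : E * M = PowerSeries.C P) (N : ℕ) :
    K = ∑ n ∈ Finset.range N,
      PowerSeries.C (PowerSeries.coeff 0 (quotient E K n)) * (PowerSeries.X ^ 2 * M) ^ n +
        quotient E K N * (PowerSeries.X ^ 2 * M) ^ N := by
  induction N with
  | zero => simp [quotient]
  | succ N ih =>
    rw [Finset.sum_range_succ, pow_succ' (PowerSeries.X ^ 2 * M) N,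
      ← mul_assoc (quotient E K (N + 1)), add_assoc, ← add_mul,
      ← quotient_eq_C_add hE hK hEP hKP hEM N]
    exact ih

theorem coeff_mul_X_sq_mul_pow_of_lt (A M : PowerSeries R) {m k : ℕ} (h : m < 2 * k) :
    PowerSeries.coeff m (A * (PowerSeries.X ^ 2 * M) ^ k) = 0 := by
  rw [(PowerSeries.commute_X_pow M 2).symm.mul_pow, ← pow_mul, ← mul_assoc,
    ← PowerSeries.X_pow_mul, mul_assoc, PowerSeries.coeff_X_pow_mul', if_neg (by omega)]

theorem coeff_X_sq_mul_pow_self (M : PowerSeries R) (k : ℕ) :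
    PowerSeries.coeff (2 * k) ((PowerSeries.X ^ 2 * M) ^ k) = PowerSeries.coeff 0 M ^ k := by
  rw [(PowerSeries.commute_X_pow M 2).symm.mul_pow, ← pow_mul, PowerSeries.coeff_X_pow_mul',
    if_pos le_rfl, Nat.sub_self, PowerSeries.coeff_zero_eq_constantCoeff, map_pow]

end Division

/-! ### Corner inverses and solution of the word equation. -/

section WordEquation

variable {𝕜 R : Type*} [RCLike 𝕜] [Ring R] [Algebra 𝕜 R]

variable (𝕜) in
/-- The unit `Q + a₂ / 2`, where `P + Q = 1` and `b` inverts `a₂` in the corner ring of `P`. -/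
noncomputable def cornerUnit (P a₂ b : R) (hP : P * P = P)
    (hPa : P * a₂ = a₂) (haP : a₂ * P = a₂) (hPb : P * b = b) (hbP : b * P = b)
    (hab : a₂ * b = P) (hba : b * a₂ = P) : Rˣ where
  val := (1 - P) + (2 : 𝕜)⁻¹ • a₂
  inv := (1 - P) + (2 : 𝕜) • b
  val_inv := by
    simp only [add_mul, mul_add, mul_smul_comm, smul_mul_assoc, mul_sub, sub_mul, hPb, haP, hab,
      hP, mul_one, one_mul, sub_self, zero_add]
    rw [smul_inv_smul₀ (two_ne_zero (α := 𝕜))]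
    simp
  inv_val := by
    simp only [add_mul, mul_add, mul_smul_comm, smul_mul_assoc, mul_sub, sub_mul, hPa, hbP, hba,
      hP, mul_one, one_mul, sub_self, zero_add]
    rw [inv_smul_smul₀ (two_ne_zero (α := 𝕜))]
    simp

/-- The inverse of `A` in the corner ring of `P`, where `A + (1 - P)` has constant coefficient
`u`. -/
noncomputable def cornerInverse (A : PowerSeries R) (P : R) (u : Rˣ) : PowerSeries R :=
  PowerSeries.invOfUnit (A + PowerSeries.C (1 - P)) u * PowerSeries.C P

variable {A : PowerSeries R} {P : R} {u : Rˣ}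

theorem cornerInverse_mul_C (hP : P * P = P) :
    cornerInverse A P u * PowerSeries.C P = cornerInverse A P u := by
  rw [cornerInverse, mul_assoc, ← map_mul, hP]

theorem IsEvenSeries.cornerInverse (hA : IsEvenSeries A) :
    IsEvenSeries (cornerInverse A P u) := by
  refine IsEvenSeries.mul (IsEvenSeries.invOfUnit (fun n hn => ?_) u) (isEvenSeries_C P)
  rw [map_add, hA n hn, isEvenSeries_C _ n hn, add_zero]

/-- Adding `1 - P` makes `A` invertible among all power series, and multiplying the sum by `P` on
the right gives `A` back. -/
theorem cornerInverse_mul (hP : P * P = P) (hPA : PowerSeries.C P * A = A)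
    (hAP : A * PowerSeries.C P = A) (hu : PowerSeries.coeff 0 A + (1 - P) = u) :
    cornerInverse A P u * A = PowerSeries.C P := by
  have h1 : (A + PowerSeries.C (1 - P)) * PowerSeries.C P = A := by
    rw [add_mul, hAP, ← map_mul, sub_mul, one_mul, hP, sub_self, map_zero, add_zero]
  have h2 : PowerSeries.invOfUnit (A + PowerSeries.C (1 - P)) u *
      (A + PowerSeries.C (1 - P)) = 1 :=
    PowerSeries.invOfUnit_mul _ u (by
      rw [← hu, ← PowerSeries.coeff_zero_eq_constantCoeff_apply]; simp)
  rw [cornerInverse, mul_assoc, hPA]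
  nth_rewrite 2 [← h1]
  rw [← mul_assoc, h2, one_mul]

variable (𝕜) in
/-- The exponential generating series of the Taylor coefficients of the memory kernel. -/
noncomputable def kernelSeries (a : ℕ → R) : PowerSeries R :=
  PowerSeries.mk fun m => (m ! : 𝕜)⁻¹ • bipartition a (m + 2)

variable {a : ℕ → R}

theorem kernelSeries_isEven (hodd : ∀ k, a (2 * k + 1) = 0) :
    IsEvenSeries (kernelSeries 𝕜 a) := fun n hn => by
  rw [kernelSeries, PowerSeries.coeff_mk, bipartition_odd hodd _ (hn.add_even (by decide)),
    smul_zero]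

theorem kernelSeries_mul_C (haP : ∀ n, a n * P = a n) :
    kernelSeries 𝕜 a * PowerSeries.C P = kernelSeries 𝕜 a := by
  ext n
  rw [PowerSeries.coeff_mul_C, kernelSeries, PowerSeries.coeff_mk, smul_mul_assoc,
    bipartition_mul haP]

theorem shiftTwo_expSeries_isEven (hodd : ∀ k, a (2 * k + 1) = 0) :
    IsEvenSeries (shiftTwo (expSeries 𝕜 a)) := fun n hn => by
  obtain ⟨k, rfl⟩ := hn
  simp [shiftTwo, expSeries, show 2 * k + 1 + 2 = 2 * (k + 1) + 1 by ring, hodd]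

theorem expSeries_eq (h1 : a 1 = 0) :
    expSeries 𝕜 a = PowerSeries.X ^ 2 * shiftTwo (expSeries 𝕜 a) := by
  ext m
  rw [PowerSeries.coeff_X_pow_mul']
  rcases m with _ | _ | m
  · simp [expSeries]
  · simp [expSeries, h1]
  · simp [shiftTwo]

/-- This is the coefficient of `X^n` after `n + 1` divisions: the remainder starts in degree `2n +
2`, and the `k = 0` summand is a constant, invisible for `n ≥ 1`. -/
theorem bipartition_eq_sum {E : PowerSeries R} (h1 : a 1 = 0) (hodd : ∀ k, a (2 * k + 1) = 0)
    (haP : ∀ n, a n * P = a n) (hE : IsEvenSeries E) (hEP : E * PowerSeries.C P = E)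
    (hEM : E * shiftTwo (expSeries 𝕜 a) = PowerSeries.C P) {n : ℕ} (hn : 1 ≤ n) :
    bipartition a (n + 2) = ∑ k ∈ Finset.Icc 1 n,
      ((k ! : 𝕜) • PowerSeries.coeff 0 (quotient E (kernelSeries 𝕜 a) k)) * bellII 𝕜 a n k := by
  have h := congrArg (PowerSeries.coeff n) (eq_sum_quotient hE (kernelSeries_isEven (𝕜 := 𝕜) hodd)
    hEP (kernelSeries_mul_C haP) hEM (n + 1))
  rw [map_add, coeff_mul_X_sq_mul_pow_of_lt _ _ (by omega), add_zero, ← expSeries_eq h1,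
    map_sum, Finset.range_eq_Ico, Finset.sum_eq_sum_Ico_succ_bot (by omega), pow_zero, mul_one,
    PowerSeries.coeff_C, if_neg (by omega), zero_add, kernelSeries, PowerSeries.coeff_mk] at h
  have hf : (n ! : 𝕜) ≠ 0 := Nat.cast_ne_zero.2 (Nat.factorial_ne_zero n)
  rw [← one_smul 𝕜 (bipartition a (n + 2)), ← mul_inv_cancel₀ hf, ← smul_smul, h,
    Finset.smul_sum]
  refine Finset.sum_congr rfl fun k _ => ?_
  have hk : (k ! : 𝕜) ≠ 0 := Nat.cast_ne_zero.2 (Nat.factorial_ne_zero k)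
  rw [bellII_eq_coeff_pow, smul_mul_smul_comm, PowerSeries.coeff_C_mul, mul_div_cancel₀ _ hk]
  rfl

/-- As `a 1 = 0`, the exponential series has order at least two, so its `k`-th power starts in
degree `2k` or later. -/
theorem bellII_eq_zero_of_lt (h1 : a 1 = 0) {n k : ℕ} (h : n < 2 * k) : bellII 𝕜 a n k = 0 := by
  rw [bellII_eq_coeff_pow, expSeries_eq h1, ← one_mul ((_ : PowerSeries R) ^ k),
    coeff_mul_X_sq_mul_pow_of_lt _ _ h, smul_zero]

theorem bellII_two_mul_self (h1 : a 1 = 0) (n : ℕ) :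
    bellII 𝕜 a (2 * n) n = (((2 * n)! : 𝕜) / (n ! * 2 ^ n : 𝕜)) • a 2 ^ n := by
  rw [bellII_eq_coeff_pow, expSeries_eq h1, coeff_X_sq_mul_pow_self]
  have : PowerSeries.coeff 0 (shiftTwo (expSeries 𝕜 a)) = (2 : 𝕜)⁻¹ • a 2 := by
    simp [shiftTwo, expSeries]
  rw [this, smul_pow, smul_smul]
  congr 1
  rw [inv_pow, ← div_eq_mul_inv, div_div]

end WordEquation

/-! ### Norm bounds for inversion and division. -/

section Bounds

variable {R : Type*} [NormedRing R]

theorem norm_coeff_invOfUnit_le {A : PowerSeries R} {C r : ℝ} (hC : 0 ≤ C) (hr : 0 ≤ r)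
    (hA : ∀ n, ‖PowerSeries.coeff n A‖ ≤ C * r ^ n) (u : Rˣ) (n : ℕ) :
    ‖PowerSeries.coeff n (PowerSeries.invOfUnit A u)‖ ≤
      ‖(↑u⁻¹ : R)‖ * (r * (1 + C * ‖(↑u⁻¹ : R)‖)) ^ n := by
  set β := ‖(↑u⁻¹ : R)‖
  have hβ : 0 ≤ β := norm_nonneg _
  -- Closed form of the majorant recursion. The summand `r ^ n` is spare; it is matched with the
  -- index `j = n`, whose term in the recursion of the inverse is zero.
  have hgeom : ∀ n : ℕ, C * β * ∑ j ∈ Finset.range n, r ^ (n - j) * (r * (1 + C * β)) ^ j +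
      r ^ n = (r * (1 + C * β)) ^ n := by
    intro n
    induction n with
    | zero => simp
    | succ n ih =>
      have h1 : ∑ j ∈ Finset.range n, r ^ (n + 1 - j) * (r * (1 + C * β)) ^ j =
          r * ∑ j ∈ Finset.range n, r ^ (n - j) * (r * (1 + C * β)) ^ j := by
        rw [Finset.mul_sum]
        refine Finset.sum_congr rfl fun j hj => ?_
        have := Finset.mem_range.1 hj
        rw [show n + 1 - j = n - j + 1 by omega]
        ring
      rw [Finset.sum_range_succ, h1, show n + 1 - n = 1 by omega]
      linear_combination r * ih
  induction n using Nat.strong_induction_on with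
  | _ n ih =>
    rcases Nat.eq_zero_or_pos n with rfl | hn
    · simp [PowerSeries.coeff_invOfUnit, β]
    · rw [PowerSeries.coeff_invOfUnit, if_neg hn.ne']
      rw [Finset.Nat.sum_antidiagonal_eq_sum_range_succ_mk, ← Finset.sum_range_reflect]
      rw [neg_mul, norm_neg]
      refine (norm_mul_le _ _).trans (mul_le_mul_of_nonneg_left ?_ hβ)
      refine (norm_sum_le _ _).trans ?_
      rw [← hgeom n, Finset.sum_range_succ, Finset.mul_sum]
      refine add_le_add (Finset.sum_le_sum fun j hj => ?_) ?_
      · have hj' := Finset.mem_range.1 hj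
        have e1 : n + 1 - 1 - j = n - j := by omega
        have e2 : n - (n - j) = j := by omega
        simp only [Nat.succ_eq_add_one, e1, e2, if_pos hj']
        refine (norm_mul_le _ _).trans ?_
        refine (mul_le_mul (hA _) (ih j hj') (norm_nonneg _) (by positivity)).trans_eq ?_
        ring
      · simp only [Nat.succ_eq_add_one, Nat.add_sub_cancel, Nat.sub_self, Nat.sub_zero,
          lt_irrefl, if_false, norm_zero]
        positivity

/-- Since `E` has the smaller rate `r / 2`, the convolution with it costs a geometric sum of at most
`2` and keeps the rate `r` in `m`; the shift by two costs `r ^ 2`. Thus all quotients can be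
evaluated on one common interval. -/
theorem norm_coeff_quotient_le {E K : PowerSeries R} {C D r : ℝ} (hC : 0 ≤ C) (hD : 0 ≤ D)
    (hr : 0 ≤ r) (hE : ∀ m, ‖PowerSeries.coeff m E‖ ≤ D * (r / 2) ^ m)
    (hK : ∀ m, ‖PowerSeries.coeff m K‖ ≤ C * r ^ m) (n m : ℕ) :
    ‖PowerSeries.coeff m (quotient E K n)‖ ≤ C * (2 * D * r ^ 2) ^ n * r ^ m := by
  induction n generalizing m with
  | zero => simpa [quotient] using hK m
  | succ n ih =>
    rw [quotient, PowerSeries.coeff_mul, Finset.Nat.sum_antidiagonal_eq_sum_range_succ_mk]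
    refine (norm_sum_le _ _).trans ?_
    have hgeom : ∑ i ∈ Finset.range (m + 1), (1 / 2 : ℝ) ^ (m - i) ≤ 2 := by
      have h := Finset.sum_range_reflect (fun i => (1 / 2 : ℝ) ^ i) (m + 1)
      simp only [Nat.add_sub_cancel] at h
      rw [h]
      exact sum_geometric_two_le _
    calc _ ≤ ∑ i ∈ Finset.range (m + 1),
          C * (2 * D * r ^ 2) ^ n * (D * r ^ 2) * r ^ m * (1 / 2 : ℝ) ^ (m - i) := by
          refine Finset.sum_le_sum fun i hi => (norm_mul_le _ _).trans ?_
          rw [shiftTwo, PowerSeries.coeff_mk]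
          refine (mul_le_mul (ih _) (hE _) (norm_nonneg _) (by positivity)).trans_eq ?_
          have hi' : m = i + (m - i) := by have := Finset.mem_range.1 hi; omega
          rw [show r ^ m = r ^ i * r ^ (m - i) by rw [← pow_add, ← hi'], div_pow, div_pow,
            one_pow]
          ring
      _ ≤ C * (2 * D * r ^ 2) ^ n * (D * r ^ 2) * r ^ m * 2 := by
          rw [← Finset.mul_sum]
          exact mul_le_mul_of_nonneg_left hgeom (by positivity)
      _ = _ := by ring

end Bounds

/-! ### Graphs of unbounded operators. -/

section Unbounded

variable {𝕜 X : Type*} [Field 𝕜] [AddCommGroup X] [Module 𝕜 X]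

theorem exists_of_mem_graph_pcomp {g f : X →ₗ.[𝕜] X} {x z : X} (h : (x, z) ∈ (pcomp g f).graph) :
    ∃ y, (x, y) ∈ f.graph ∧ (y, z) ∈ g.graph := by
  obtain ⟨ξ, rfl, rfl⟩ := (LinearPMap.mem_graph_iff _).1 h
  obtain ⟨y, hy, hyξ⟩ := ξ.2.1
  have hmem : f ⟨ξ, ξ.2.2⟩ ∈ g.domain := by
    rwa [show (⟨ξ, ξ.2.2⟩ : f.domain) = y from Subtype.ext hyξ.symm]
  exact ⟨f ⟨ξ, ξ.2.2⟩, f.mem_graph ⟨ξ, ξ.2.2⟩, g.mem_graph ⟨_, hmem⟩⟩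

theorem pval_mem_graph {A : X →ₗ.[𝕜] X} {x : X} (h : x ∈ A.domain) : (x, pval A x) ∈ A.graph := by
  rw [pval, dif_pos h]
  exact A.mem_graph ⟨x, h⟩

theorem pval_eq {A : X →ₗ.[𝕜] X} {x y : X} (h : (x, y) ∈ A.graph) : pval A x = y :=
  A.mem_graph_snd_inj (pval_mem_graph (LinearPMap.mem_domain_of_mem_graph h)) h rfl

end Unbounded

/-! ### Bounded iterates, the Dyson identity and convolutions. -/

section Operators

variable {𝕜 X : Type*} [RCLike 𝕜] [NormedAddCommGroup X] [NormedSpace 𝕜 X]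

/-- Here `l n = Aⁿ P`. If `l n` is bounded, closedness of `A` makes the graph of `l (n + 1)` closed,
and the closed graph theorem applies. -/
theorem exists_compressedPow_eq [CompleteSpace X] {A : X →ₗ.[𝕜] X} (hA : A.IsClosed)
    (P : X →L[𝕜] X) (hdom : ∀ n, LinearMap.range (P : X →ₗ[𝕜] X) ≤ (ppow A n).domain) :
    ∃ l : ℕ → X →L[𝕜] X, l 0 = P ∧ (∀ n x, (l n x, l (n + 1) x) ∈ A.graph) ∧
      ∀ n, compressedPow (P : X →ₗ[𝕜] X) A hdom n = ((P * l n : X →L[𝕜] X) : X →ₗ[𝕜] X) := by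
  let m : ℕ → X →ₗ[𝕜] X := fun n => (ppow A n).toFun ∘ₗ
    (P : X →ₗ[𝕜] X).codRestrict (ppow A n).domain (fun x => hdom n ⟨x, rfl⟩)
  have hm : ∀ n x, (P x, m n x) ∈ (ppow A n).graph := fun n x =>
    (ppow A n).mem_graph ⟨P x, hdom n ⟨x, rfl⟩⟩
  have hm0 : ∀ x, m 0 x = P x := fun x => rfl
  have hsucc : ∀ n x, (m n x, m (n + 1) x) ∈ A.graph := by
    intro n x
    obtain ⟨y, h1, h2⟩ := exists_of_mem_graph_pcomp (hm (n + 1) x)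
    rwa [(ppow A n).mem_graph_snd_inj h1 (hm n x) rfl] at h2
  have hcont : ∀ n, Continuous (m n) := by
    intro n
    induction n with
    | zero => exact P.continuous
    | succ n ih =>
      refine (m (n + 1)).continuous_of_seq_closed_graph fun u x y hu hy => ?_
      have h1 : Tendsto (fun i => (m n (u i), m (n + 1) (u i))) atTop (𝓝 (m n x, y)) :=
        ((ih.tendsto x).comp hu).prodMk_nhds hy
      have h2 : (m n x, y) ∈ A.graph :=
        IsClosed.mem_of_tendsto hA h1 (Eventually.of_forall fun i => hsucc n (u i))
      exact A.mem_graph_snd_inj h2 (hsucc n x) rfl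
  refine ⟨fun n => ⟨m n, hcont n⟩, ?_, hsucc, fun n => rfl⟩
  ext x
  exact hm0 x

theorem map_mem_graph_closure {L : X →ₗ.[𝕜] X} {Q : X →L[𝕜] X} (hL : L.IsClosable)
    (hQL : ((Q : X →ₗ[𝕜] X).compPMap L).IsClosable) {x y : X} (h : (x, y) ∈ L.closure.graph) :
    (x, Q y) ∈ ((Q : X →ₗ[𝕜] X).compPMap L).closure.graph := by
  rw [← hL.graph_closure_eq_closure_graph] at h
  rw [← hQL.graph_closure_eq_closure_graph]
  refine map_mem_closure (f := fun z : X × X => (z.1, Q z.2)) (by fun_prop) h ?_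
  rintro ⟨u, v⟩ huv
  obtain ⟨w, rfl, rfl⟩ := (LinearPMap.mem_graph_iff _).1 huv
  exact ((Q : X →ₗ[𝕜] X).compPMap L).mem_graph w

theorem apply_eq_zero_of_mem_graph_closure {L : X →ₗ.[𝕜] X} {P Q : X →L[𝕜] X} (hPQ0 : P * Q = 0)
    (hQL : ((Q : X →ₗ[𝕜] X).compPMap L).IsClosable) {x y : X}
    (h : (x, y) ∈ ((Q : X →ₗ[𝕜] X).compPMap L).closure.graph) : P y = 0 := by
  rw [← hQL.graph_closure_eq_closure_graph] at h
  have hcl : IsClosed {z : X × X | P z.2 = 0} :=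
    isClosed_eq (by fun_prop) continuous_const
  refine closure_minimal (s := (((Q : X →ₗ[𝕜] X).compPMap L).graph : Set (X × X))) ?_ hcl h
  rintro ⟨u, v⟩ huv
  obtain ⟨w, rfl, rfl⟩ := (LinearPMap.mem_graph_iff _).1 huv
  exact congrArg (fun B : X →L[𝕜] X => B (L w)) hPQ0

variable [NormedSpace ℝ X] [IsScalarTower ℝ 𝕜 X]

theorem hasDerivWithinAt_clm_apply {f : ℝ → X} {f' : X} {s : Set ℝ} {t : ℝ} (P : X →L[𝕜] X)
    (h : HasDerivWithinAt f f' s t) : HasDerivWithinAt (fun s => P (f s)) (P f') s t :=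
  (P.restrictScalars ℝ).hasFDerivAt.comp_hasDerivWithinAt t h

theorem clm_intervalIntegral_comm [CompleteSpace X] (P : X →L[𝕜] X) {f : ℝ → X} {t : ℝ}
    (hf : IntervalIntegrable f MeasureTheory.volume 0 t) :
    ∫ s in (0 : ℝ)..t, P (f s) = P (∫ s in (0 : ℝ)..t, f s) :=
  (P.restrictScalars ℝ).intervalIntegral_comp_comm hf

/-- The `s`-derivative of `e^{(t-s)L} e^{sQL} w` is `e^{(t-s)L} (QL - L) e^{sQL} w = -e^{(t-s)L} P L
e^{sQL} w`. After integration and an application of `P`, the endpoint `P e^{tQL} w` drops out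
because the orbit stays in the kernel of `P`. -/
theorem dyson [CompleteSpace X] {P Q : X →L[𝕜] X} (hPQ : P + Q = 1) (hPQ0 : P * Q = 0)
    {L : X →ₗ.[𝕜] X} {T S : ℝ → X →L[𝕜] X} (hL : L.IsClosable) (hT : Generates L.closure T)
    (hQL : ((Q : X →ₗ[𝕜] X).compPMap L).IsClosable)
    (hS : Generates ((Q : X →ₗ[𝕜] X).compPMap L).closure S) {w : X} (hw : P w = 0)
    (hmem : ∀ t : ℝ, 0 ≤ t → S t w ∈ L.closure.domain)
    (hcont : ContinuousOn (fun t => P (pval L.closure (S t w))) (Ici 0)) {t : ℝ} (ht : 0 ≤ t) :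
    P (T t w) = ∫ s in (0 : ℝ)..t, P (T (t - s) (P (pval L.closure (S s w)))) := by
  -- On the orbit the closure of `QL` acts as `Q` after the closure of `L`, because every orbit
  -- point lies in the domain of the latter.
  have hSw : ∀ s, 0 ≤ s → HasDerivWithinAt (fun s => S s w) (Q (pval L.closure (S s w))) (Ici 0) s ∧
      P (Q (pval L.closure (S s w))) = 0 := by
    intro s hs
    have hw0 : w ∈ L.closure.domain := by simpa [hS.1.zero] using hmem 0 le_rfl
    have h1 := map_mem_graph_closure hL hQL (pval_mem_graph hw0)
    have h2 := map_mem_graph_closure hL hQL (pval_mem_graph (hmem s hs))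
    have h3 := LinearPMap.mem_graph_snd_inj _ (hS.apply_mem_graph h1 hs) h2 rfl
    refine ⟨h3 ▸ hS.hasDerivWithinAt h1 hs, apply_eq_zero_of_mem_graph_closure hPQ0 hQL h2⟩
  have hPS : P (S t w) = 0 := by
    have h1 : ∀ s ∈ Icc 0 t, HasDerivWithinAt (fun s => P (S s w)) 0 (Icc 0 t) s := by
      intro s hs
      have := hasDerivWithinAt_clm_apply P (hSw s hs.1).1
      rw [(hSw s hs.1).2] at this
      exact this.mono Icc_subset_Ici_self
    have h2 := norm_image_sub_le_of_norm_deriv_le_segment' h1 (C := 0) (fun s _ => by simp) t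
      ⟨ht, le_rfl⟩
    simpa [hS.1.zero, hw] using h2
  have hderiv : ∀ s ∈ Icc 0 t, HasDerivWithinAt (fun s => T (t - s) (S s w))
      (-T (t - s) (P (pval L.closure (S s w)))) (Icc 0 t) s := by
    intro s hs
    have h1 := hT.hasDerivWithinAt_apply_sub hs ((hSw s hs.1).1.mono Icc_subset_Ici_self)
      (pval_mem_graph (hmem s hs.1))
    refine h1.congr_deriv ?_
    rw [← map_neg]
    congr 1
    have := congrArg (fun B : X →L[𝕜] X => B (pval L.closure (S s w))) hPQ
    simp only [add_apply, one_apply_eq_self] at this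
    nth_rewrite 2 [← this]
    abel
  have hK : ContinuousOn (fun s => T (t - s) (P (pval L.closure (S s w)))) (Icc 0 t) :=
    hT.1.continuousOn_apply (by fun_prop) (fun s hs => by linarith [hs.2])
      (hcont.mono Icc_subset_Ici_self)
  have hint : IntervalIntegrable (fun s => T (t - s) (P (pval L.closure (S s w))))
      MeasureTheory.volume 0 t := by
    refine ContinuousOn.intervalIntegrable ?_
    rwa [uIcc_of_le ht]
  have h := intervalIntegral.integral_eq_sub_of_hasDeriv_right_of_le ht
    (fun s hs => (hderiv s hs).continuousWithinAt)
    (fun s hs => (hderiv s (Ioo_subset_Icc_self hs)).mono_of_mem_nhdsWithin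
      (Icc_mem_nhdsGT_of_mem ⟨hs.1.le, hs.2⟩)) hint.neg
  simp only [intervalIntegral.integral_neg, sub_self, sub_zero, hT.1.zero, hS.1.zero,
    one_apply_eq_self] at h
  rw [clm_intervalIntegral_comm P hint, neg_eq_iff_eq_neg.1 h, map_neg, map_sub, hPS]
  simp

section Iterates

variable {P : X →L[𝕜] X} {A : X →ₗ.[𝕜] X} {T : ℝ → X →L[𝕜] X} {l : ℕ → X →L[𝕜] X}

theorem hasDerivWithinAt_iterate [CompleteSpace X] (hT : Generates A T)
    (hl : ∀ n x, (l n x, l (n + 1) x) ∈ A.graph) (P : X →L[𝕜] X) (n : ℕ) (x : X) {t : ℝ}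
    (ht : 0 ≤ t) :
    HasDerivWithinAt (fun t => P (T t (l n x))) (P (T t (l (n + 1) x))) (Ici 0) t :=
  hasDerivWithinAt_clm_apply P (hT.hasDerivWithinAt (hl n x) ht)

theorem iteratedDerivWithin_projected [CompleteSpace X] (hT : Generates A T) (hl0 : l 0 = P)
    (hl : ∀ n x, (l n x, l (n + 1) x) ∈ A.graph) (n : ℕ) (x : X) {t : ℝ} (ht : 0 ≤ t) :
    iteratedDerivWithin n (projected P T x) (Ici 0) t = P (T t (l n x)) := by
  induction n generalizing t with
  | zero => rw [iteratedDerivWithin_zero, hl0]; rfl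
  | succ n ih =>
    rw [iteratedDerivWithin_succ, derivWithin_congr (s := Ici 0)
      (f := fun s => P (T s (l n x))) (fun s hs => ih (mem_Ici.1 hs)) (ih ht)]
    exact (hasDerivWithinAt_iterate hT hl P n x ht).derivWithin (uniqueDiffOn_Ici 0 t ht)

theorem coe_pow_smul_inv_factorial_smul (t : ℝ) (m : ℕ) (x : X) :
    (t : 𝕜) ^ m • (m ! : 𝕜)⁻¹ • x = (t ^ m / (m ! : ℝ)) • x := by
  rw [RCLike.real_smul_eq_coe_smul (K := 𝕜), smul_smul, div_eq_mul_inv]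
  push_cast
  rfl

/-- Differentiating the remainder for `l i` gives the remainder of one order less for `l (i + 1)`,
so the mean value inequality drives the induction. The bound is linear in `‖x‖` and hence yields
expansions in operator norm. -/
theorem exists_norm_taylor_le [CompleteSpace X] (hT : Generates A T)
    (hl : ∀ n x, (l n x, l (n + 1) x) ∈ A.graph) (P : X →L[𝕜] X) (n i : ℕ) :
    ∃ C, 0 ≤ C ∧ ∀ t ∈ Icc (0 : ℝ) 1, ∀ x, ‖P (T t (l i x)) -
      ∑ j ∈ Finset.range n, (t ^ j / (j ! : ℝ)) • P (l (i + j) x)‖ ≤ C * t ^ n * ‖x‖ := by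
  induction n generalizing i with
  | zero =>
    obtain ⟨M, hM0, hM⟩ := hT.1.exists_norm_le 1
    refine ⟨‖P‖ * (M * ‖l i‖), by positivity, fun t ht x => ?_⟩
    simp only [Finset.range_zero, Finset.sum_empty, sub_zero, pow_zero, mul_one]
    rw [mul_assoc, mul_assoc]
    exact P.le_opNorm_of_le ((T t).le_of_opNorm_le_of_le (hM t ht) ((l i).le_opNorm x))
  | succ n ih =>
    obtain ⟨C, hC0, hC⟩ := ih (i + 1)
    refine ⟨C, hC0, fun τ hτ x => ?_⟩
    have hd : ∀ t ∈ Icc 0 τ, HasDerivWithinAt (fun t => P (T t (l i x)) -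
        ∑ j ∈ Finset.range (n + 1), (t ^ j / (j ! : ℝ)) • P (l (i + j) x))
        (P (T t (l (i + 1) x)) -
          ∑ j ∈ Finset.range n, (t ^ j / (j ! : ℝ)) • P (l (i + 1 + j) x)) (Icc 0 τ) t := by
      intro t ht
      refine ((hasDerivWithinAt_iterate hT hl P i x ht.1).mono Icc_subset_Ici_self).sub ?_
      simp only [Finset.sum_range_succ' _ n]
      simp only [pow_zero, Nat.factorial_zero, Nat.cast_one, div_one, one_smul]
      refine HasDerivWithinAt.add_const _ (HasDerivWithinAt.fun_sum fun j _ => ?_)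
      rw [show i + (j + 1) = i + 1 + j by ring]
      refine HasDerivWithinAt.smul_const (HasDerivAt.hasDerivWithinAt ?_) _
      refine (((hasDerivAt_id' t).fun_pow (j + 1)).div_const ((j + 1)! : ℝ)).congr_deriv ?_
      simp only [Nat.factorial_succ, Nat.add_sub_cancel]
      push_cast
      have : (j ! : ℝ) ≠ 0 := by positivity
      have : (j : ℝ) + 1 ≠ 0 := by positivity
      field_simp
    have hb : ∀ t ∈ Ico 0 τ, ‖P (T t (l (i + 1) x)) -
        ∑ j ∈ Finset.range n, (t ^ j / (j ! : ℝ)) • P (l (i + 1 + j) x)‖ ≤ C * τ ^ n * ‖x‖ := by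
      intro t ht
      refine (hC t ⟨ht.1, ht.2.le.trans hτ.2⟩ x).trans ?_
      have := ht.1
      have := ht.2.le
      gcongr
    have h := norm_image_sub_le_of_norm_deriv_le_segment' hd hb τ ⟨hτ.1, le_rfl⟩
    have h0 : P (T 0 (l i x)) -
        ∑ j ∈ Finset.range (n + 1), ((0 : ℝ) ^ j / (j ! : ℝ)) • P (l (i + j) x) = 0 := by
      rw [Finset.sum_range_succ']
      simp [hT.1.zero]
    simp only [h0, sub_zero] at h
    refine h.trans_eq ?_
    ring

theorem hasExpansion_iterate [CompleteSpace X] (hT : Generates A T)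
    (hl : ∀ n x, (l n x, l (n + 1) x) ∈ A.graph) (P : X →L[𝕜] X) (i : ℕ) :
    HasExpansion 𝕜 (fun t => P * T t * l i) fun m => (m ! : 𝕜)⁻¹ • (P * l (i + m)) := by
  intro M
  obtain ⟨C, hC0, hC⟩ := exists_norm_taylor_le hT hl P M i
  refine isBigO_nhdsGE_pow_iff.2 ⟨1, one_pos, C, hC0, fun t ht => ?_⟩
  refine ContinuousLinearMap.opNorm_le_bound _ (mul_nonneg hC0 (pow_nonneg ht.1 M)) fun x => ?_
  refine le_of_eq_of_le (congrArg norm ?_) (hC t ht x)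
  simp only [sub_apply, sum_apply, smul_apply, coe_pow_smul_inv_factorial_smul]
  rfl

end Iterates

section Convolution

theorem integral_polynomial_convolution [CompleteSpace X] (t : ℝ) (x : X) (i j : ℕ) :
    ∫ s in (0 : ℝ)..t, ((t - s : ℝ) : 𝕜) ^ i • (i ! : 𝕜)⁻¹ • (s : 𝕜) ^ j • (j ! : 𝕜)⁻¹ • x =
      (t : 𝕜) ^ (i + j + 1) • ((i + j + 1)! : 𝕜)⁻¹ • x := by
  have h : ∀ s : ℝ, ((t - s : ℝ) : 𝕜) ^ i • (i ! : 𝕜)⁻¹ • (s : 𝕜) ^ j • (j ! : 𝕜)⁻¹ • x =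
      (((t - s) ^ i / (i ! : ℝ)) * (s ^ j / (j ! : ℝ))) • x := fun s => by
    rw [coe_pow_smul_inv_factorial_smul, coe_pow_smul_inv_factorial_smul, smul_smul]
  simp only [h]
  rw [intervalIntegral.integral_smul_const, integral_sub_pow_mul_pow,
    coe_pow_smul_inv_factorial_smul]

/-- Replacing both factors by their Taylor polynomials costs `O(t^M)` in the integrand, hence
`O(t^(M+1))` after integration; the polynomial part is a Beta integral. Integrability is assumed
because `p` need not be norm continuous. -/
theorem HasExpansion.convolution [CompleteSpace X] {p : ℝ → X →L[𝕜] X} {k : ℝ → X}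
    {a : ℕ → X →L[𝕜] X} {κ c : ℕ → X} (hp : HasExpansion 𝕜 p fun i => (i ! : 𝕜)⁻¹ • a i)
    (hk : HasExpansion 𝕜 k fun j => (j ! : 𝕜)⁻¹ • κ j)
    (hint : ∀ t, 0 ≤ t → IntervalIntegrable (fun s => p (t - s) (k s)) MeasureTheory.volume 0 t)
    (hc0 : c 0 = 0) (hc : ∀ n, c (n + 1) = ((n + 1)! : 𝕜)⁻¹ •
      ∑ q ∈ Finset.HasAntidiagonal.antidiagonal n, a q.1 (κ q.2)) :
    HasExpansion 𝕜 (fun t => ∫ s in (0 : ℝ)..t, p (t - s) (k s)) c := by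
  have key : ∀ M, (fun t => (∫ s in (0 : ℝ)..t, p (t - s) (k s)) -
      ∑ m ∈ Finset.range (M + 1), (t : 𝕜) ^ m • c m) =O[𝓝[≥] 0] fun t : ℝ => t ^ (M + 1) := by
    intro M
    let pM : ℝ → X →L[𝕜] X := fun t => ∑ i ∈ Finset.range M, (t : 𝕜) ^ i • (i ! : 𝕜)⁻¹ • a i
    let kM : ℝ → X := fun t => ∑ j ∈ Finset.range M, (t : 𝕜) ^ j • (j ! : 𝕜)⁻¹ • κ j
    have hpc : Continuous pM := by fun_prop
    have hkc : Continuous kM := by fun_prop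
    obtain ⟨ε₁, hε₁, C₁, hC₁, h1⟩ := isBigO_nhdsGE_pow_iff.1 (hp M)
    obtain ⟨ε₂, hε₂, C₂, hC₂, h2⟩ := isBigO_nhdsGE_pow_iff.1 (hk M)
    obtain ⟨ε₃, hε₃, C₃, hC₃, h3⟩ := isBigO_nhdsGE_pow_iff.1 (hk 0)
    obtain ⟨C₄, hC₄⟩ := (isCompact_Icc (a := (0 : ℝ)) (b := 1)).exists_bound_of_continuousOn
      hpc.continuousOn
    have hC₄0 : 0 ≤ C₄ := (norm_nonneg _).trans (hC₄ 0 (by simp))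
    set ε := min (min ε₁ ε₂) (min ε₃ 1)
    have hε : 0 < ε := by positivity
    have hdiff : (fun t => ∫ s in (0 : ℝ)..t, (p (t - s) (k s) - pM (t - s) (kM s)))
        =O[𝓝[≥] 0] fun t : ℝ => t ^ (M + 1) := by
      refine isBigO_integral_nhdsGE (C := C₁ * C₃ + C₄ * C₂) hε fun t ht s hs => ?_
      have b1 : ε ≤ ε₁ := (min_le_left _ _).trans (min_le_left _ _)
      have b2 : ε ≤ ε₂ := (min_le_left _ _).trans (min_le_right _ _)
      have b3 : ε ≤ ε₃ := (min_le_right _ _).trans (min_le_left _ _)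
      have b4 : ε ≤ 1 := (min_le_right _ _).trans (min_le_right _ _)
      obtain ⟨hs0, hst⟩ := hs
      have e : p (t - s) (k s) - pM (t - s) (kM s) =
          (p (t - s) - pM (t - s)) (k s) + pM (t - s) (k s - kM s) := by
        rw [sub_apply, map_sub]; abel
      have i1 := h1 (t - s) ⟨by linarith, by linarith⟩
      have i2 := h2 s ⟨hs0, by linarith⟩
      have i3 := h3 s ⟨hs0, by linarith⟩
      have i4 := hC₄ (t - s) ⟨by linarith, by linarith⟩
      simp only [Finset.range_zero, Finset.sum_empty, sub_zero, pow_zero, mul_one] at i3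
      have j1 : C₁ * (t - s) ^ M ≤ C₁ * t ^ M := by
        gcongr
        all_goals linarith
      have j2 : C₂ * s ^ M ≤ C₂ * t ^ M := by gcongr
      rw [e]
      refine (norm_add_le _ _).trans ?_
      calc _ ≤ (C₁ * t ^ M) * C₃ + C₄ * (C₂ * t ^ M) :=
            add_le_add (ContinuousLinearMap.le_of_opNorm_le_of_le _ (i1.trans j1) i3)
              (ContinuousLinearMap.le_of_opNorm_le_of_le _ i4 (i2.trans j2))
        _ = _ := by ring
    have hpoly : ∀ t : ℝ, ∫ s in (0 : ℝ)..t, pM (t - s) (kM s) =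
        ∑ i ∈ Finset.range M, ∑ j ∈ Finset.range M,
          (t : 𝕜) ^ (i + j + 1) • ((i + j + 1)! : 𝕜)⁻¹ • a i (κ j) := by
      intro t
      simp only [← integral_polynomial_convolution]
      have hci : ∀ i j : ℕ, IntervalIntegrable (fun s : ℝ => ((t - s : ℝ) : 𝕜) ^ i •
          (i ! : 𝕜)⁻¹ • (s : 𝕜) ^ j • (j ! : 𝕜)⁻¹ • a i (κ j)) MeasureTheory.volume 0 t :=
        fun i j => Continuous.intervalIntegrable (by fun_prop) _ _
      rw [← intervalIntegral.integral_congr (g := fun s => pM (t - s) (kM s)) (f := fun s : ℝ =>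
        ∑ i ∈ Finset.range M, ∑ j ∈ Finset.range M, ((t - s : ℝ) : 𝕜) ^ i •
          (i ! : 𝕜)⁻¹ • (s : 𝕜) ^ j • (j ! : 𝕜)⁻¹ • a i (κ j))]
      · rw [intervalIntegral.integral_finsetSum]
        · refine Finset.sum_congr rfl fun i _ => ?_
          rw [intervalIntegral.integral_finsetSum fun j _ => hci i j]
        · intro i _
          exact Continuous.intervalIntegrable (by fun_prop) _ _
      · intro s _
        simp only [pM, kM, sum_apply, smul_apply, map_sum,
          map_smul, Finset.smul_sum]
        rw [Finset.sum_comm]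
        refine Finset.sum_congr rfl fun i _ => Finset.sum_congr rfl fun j _ => ?_
        simp only [smul_smul]
        congr 1
        ring
    -- The products with `i + j ≥ M`, which the truncated expansion does not contain.
    have htail : (fun t : ℝ => ∑ i ∈ Finset.range M, ∑ j ∈ Finset.Ico (M - i) M,
        (t : 𝕜) ^ (i + j + 1) • ((i + j + 1)! : 𝕜)⁻¹ • a i (κ j))
        =O[𝓝[≥] 0] fun t : ℝ => t ^ (M + 1) := by
      refine Asymptotics.IsBigO.fun_sum fun i _ => Asymptotics.IsBigO.fun_sum fun j hj => ?_
      refine (isBigO_coe_pow_smul _ _).trans (isBigO_pow_nhdsGE ?_)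
      have := Finset.mem_Ico.1 hj
      omega
    refine (hdiff.add htail).congr' ?_ EventuallyEq.rfl
    filter_upwards [self_mem_nhdsWithin] with t ht
    rw [intervalIntegral.integral_sub (hint t ht) (Continuous.intervalIntegrable (by fun_prop) _ _),
      hpoly, sub_add]
    congr 1
    rw [← Finset.sum_sub_distrib, Finset.sum_range_succ', hc0, smul_zero, add_zero]
    have hsum : ∀ n, (t : 𝕜) ^ (n + 1) • c (n + 1) =
        ∑ q ∈ Finset.HasAntidiagonal.antidiagonal n,
          (t : 𝕜) ^ (q.1 + q.2 + 1) • ((q.1 + q.2 + 1)! : 𝕜)⁻¹ • a q.1 (κ q.2) := by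
      intro n
      rw [hc, Finset.smul_sum, Finset.smul_sum]
      refine Finset.sum_congr rfl fun q hq => ?_
      rw [Finset.HasAntidiagonal.mem_antidiagonal.1 hq]
    simp only [hsum]
    rw [sum_antidiagonal_range (fun i j =>
      (t : 𝕜) ^ (i + j + 1) • ((i + j + 1)! : 𝕜)⁻¹ • a i (κ j))]
    refine Finset.sum_congr rfl fun i _ => ?_
    rw [← Finset.sum_range_add_sum_Ico _ (Nat.sub_le M i), add_sub_cancel_right]
  intro M
  cases M with
  | zero =>
    have h := (key 0).trans (isBigO_pow_nhdsGE (Nat.zero_le _))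
    simpa [hc0] using h
  | succ M => exact key M

end Convolution

end Operators

/-! ### Values of power series and the binomial collapse. -/

section Evaluation

variable {𝕜 R : Type*} [RCLike 𝕜] [NormedRing R] [NormedAlgebra 𝕜 R]

variable (𝕜) in
/-- The value at `s` of a power series. -/
noncomputable def evalSeries (A : PowerSeries R) (s : ℝ) : R :=
  ∑' m, (s : 𝕜) ^ m • PowerSeries.coeff m A

variable {A B : PowerSeries R} {C r s : ℝ}

theorem norm_pow_smul_coeff_le (hs : 0 ≤ s) (hr : 0 ≤ r) (hC : 0 ≤ C) (hsr : s * r ≤ 1 / 2)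
    (hA : ∀ m, ‖PowerSeries.coeff m A‖ ≤ C * r ^ m) (m : ℕ) :
    ‖(s : 𝕜) ^ m • PowerSeries.coeff m A‖ ≤ C * (1 / 2) ^ m := by
  rw [norm_smul, norm_pow, RCLike.norm_ofReal, abs_of_nonneg hs]
  calc s ^ m * ‖PowerSeries.coeff m A‖ ≤ s ^ m * (C * r ^ m) := by gcongr; exact hA m
    _ = C * (s * r) ^ m := by ring
    _ ≤ C * (1 / 2) ^ m := by gcongr

theorem summable_norm_evalSeries (hs : 0 ≤ s) (hr : 0 ≤ r) (hC : 0 ≤ C) (hsr : s * r ≤ 1 / 2)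
    (hA : ∀ m, ‖PowerSeries.coeff m A‖ ≤ C * r ^ m) :
    Summable fun m => ‖(s : 𝕜) ^ m • PowerSeries.coeff m A‖ :=
  Summable.of_nonneg_of_le (fun _ => norm_nonneg _) (norm_pow_smul_coeff_le hs hr hC hsr hA)
    (summable_geometric_two.mul_left C)

theorem norm_evalSeries_le (hs : 0 ≤ s) (hr : 0 ≤ r) (hC : 0 ≤ C) (hsr : s * r ≤ 1 / 2)
    (hA : ∀ m, ‖PowerSeries.coeff m A‖ ≤ C * r ^ m) : ‖evalSeries 𝕜 A s‖ ≤ 2 * C := by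
  refine tsum_of_norm_bounded ?_ (norm_pow_smul_coeff_le hs hr hC hsr hA)
  rw [mul_comm]
  exact hasSum_geometric_two.mul_left C

theorem evalSeries_mul [CompleteSpace R]
    (hA : Summable fun m => ‖(s : 𝕜) ^ m • PowerSeries.coeff m A‖)
    (hB : Summable fun m => ‖(s : 𝕜) ^ m • PowerSeries.coeff m B‖) :
    evalSeries 𝕜 (A * B) s = evalSeries 𝕜 A s * evalSeries 𝕜 B s ∧
      Summable fun m => (s : 𝕜) ^ m • PowerSeries.coeff m (A * B) := by
  have e : ∀ m, (s : 𝕜) ^ m • PowerSeries.coeff m (A * B) =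
      ∑ q ∈ Finset.HasAntidiagonal.antidiagonal m, ((s : 𝕜) ^ q.1 • PowerSeries.coeff q.1 A) *
        ((s : 𝕜) ^ q.2 • PowerSeries.coeff q.2 B) := by
    intro m
    rw [PowerSeries.coeff_mul, Finset.smul_sum]
    refine Finset.sum_congr rfl fun q hq => ?_
    rw [smul_mul_smul_comm, ← pow_add, Finset.HasAntidiagonal.mem_antidiagonal.1 hq]
  simp only [evalSeries, e]
  exact ⟨(tsum_mul_tsum_eq_tsum_sum_antidiagonal_of_summable_norm hA hB).symm,
    (summable_norm_sum_mul_antidiagonal_of_summable_norm hA hB).of_norm⟩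

theorem evalSeries_C_add {x : R} (hA : Summable fun m => (s : 𝕜) ^ m • PowerSeries.coeff m A) :
    evalSeries 𝕜 (PowerSeries.C x + A) s = x + evalSeries 𝕜 A s := by
  have h : HasSum (fun m : ℕ => (s : 𝕜) ^ m • PowerSeries.coeff m (PowerSeries.C x)) x := by
    convert hasSum_ite_eq (0 : ℕ) x using 2 with m
    rw [PowerSeries.coeff_C]
    split_ifs with hm
    · simp [hm]
    · simp
  simp only [evalSeries, map_add, smul_add]
  rw [h.summable.tsum_add hA, h.tsum_eq]

theorem norm_mul_pow_le {R : Type*} [NormedRing R] (f w : R) (n : ℕ) :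
    ‖f * w ^ n‖ ≤ ‖f‖ * ‖w‖ ^ n := by
  induction n with
  | zero => simp
  | succ n ih =>
    rw [pow_succ, ← mul_assoc, pow_succ, ← mul_assoc]
    exact (norm_mul_le _ _).trans (mul_le_mul_of_nonneg_right ih (norm_nonneg _))

/-- The factor `n!` turns the coefficients `1 / ((n-k)! k!)` into binomial coefficients. -/
theorem sum_smul_mul_pow {R : Type*} [Ring R] [Algebra 𝕜 R] (f p : R) (n : ℕ) :
    ∑ k ∈ Finset.range (n + 1), (((-1 : ℝ) ^ (n - k) / ((n - k)! * k ! : ℝ) : ℝ) : 𝕜) •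
      (((n ! : 𝕜) • f) * p ^ k) = f * (p - 1) ^ n := by
  rw [sub_eq_add_neg, (Commute.one_right p).neg_right.add_pow, Finset.mul_sum]
  refine Finset.sum_congr rfl fun k hk => ?_
  have hk' := Nat.lt_succ_iff.1 (Finset.mem_range.1 hk)
  have h1 : (n ! : 𝕜) = (n.choose k : 𝕜) * (k ! : 𝕜) * ((n - k)! : 𝕜) := by
    exact_mod_cast (Nat.choose_mul_factorial_mul_factorial hk').symm
  have h2 : ((n - k)! : 𝕜) ≠ 0 := Nat.cast_ne_zero.2 (Nat.factorial_ne_zero _)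
  have h3 : (k ! : 𝕜) ≠ 0 := Nat.cast_ne_zero.2 (Nat.factorial_ne_zero _)
  have h4 : (-1 : R) ^ (n - k) * (n.choose k : R) =
      algebraMap 𝕜 R ((-1) ^ (n - k) * (n.choose k : 𝕜)) := by simp
  rw [mul_assoc, h4, ← mul_assoc, ← Algebra.commutes, ← Algebra.smul_def, smul_mul_assoc,
    smul_smul]
  congr 1
  rw [h1]
  push_cast
  field_simp

/-- To the right of a factor that absorbs `P`, the elements `1` and `P` act alike. This matters
because `P e^{sL} P - P` is small for small `s`, while `P e^{sL} P - 1` need not be. -/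
theorem mul_sub_one_pow_eq {R : Type*} [Ring R] {f p P : R} (hf : f * P = f) (hP : P * P = P)
    (hpP : p * P = p) (n : ℕ) : f * (p - 1) ^ n = f * (p - P) ^ n := by
  have h : ∀ n, f * (p - P) ^ n * P = f * (p - P) ^ n := by
    intro n
    cases n with
    | zero => simpa using hf
    | succ n => rw [pow_succ, mul_assoc, mul_assoc, sub_mul, hpP, hP]
  induction n with
  | zero => simp
  | succ n ih =>
    rw [pow_succ, pow_succ, ← mul_assoc, ← mul_assoc, ih, mul_sub, mul_sub, mul_one, h]

end Evaluation

/-! ### Taylor coefficients of the kernel and the terms of the expansion. -/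

section MoriZwanzigEquation

variable {𝕜 X : Type*} [RCLike 𝕜] [NormedAddCommGroup X] [NormedSpace ℝ X] [NormedSpace 𝕜 X]

/-- The properties of the projection `P`, the semigroup `T = e^{tA}`, the operators `l n = Aⁿ P`
and the memory kernel `k` from which the combinatorial expansion follows. -/
structure IsDysonSystem (P : X →L[𝕜] X) (A : X →ₗ.[𝕜] X) (T : ℝ → X →L[𝕜] X)
    (l : ℕ → X →L[𝕜] X) (k : X → ℝ → X) : Prop where
  idem : P * P = P
  gen : Generates A T
  zero : l 0 = P
  succ : ∀ n x, (l n x, l (n + 1) x) ∈ A.graph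
  odd : ∀ j, P * l (2 * j + 1) = 0
  smooth : ∀ x, ContDiffOn ℝ ∞ (k x) (Ici 0)
  proj : ∀ x t, P (k x t) = k x t
  dyson : ∀ x t, 0 ≤ t → P (T t (l 1 x)) = ∫ s in (0 : ℝ)..t, P (T (t - s) (k x s))

variable {P : X →L[𝕜] X} {A : X →ₗ.[𝕜] X} {T : ℝ → X →L[𝕜] X} {l : ℕ → X →L[𝕜] X}
  {k : X → ℝ → X}

namespace IsDysonSystem

theorem l_mul (h : IsDysonSystem P A T l k) (n : ℕ) : l n * P = l n := by
  ext x
  change l n (P x) = l n x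
  induction n with
  | zero =>
    rw [h.zero]
    exact congrArg (fun B : X →L[𝕜] X => B x) h.idem
  | succ n ih => exact A.mem_graph_snd_inj (h.succ n (P x)) (h.succ n x) ih

theorem coeff_mul (h : IsDysonSystem P A T l k) (n : ℕ) : P * l n * P = P * l n := by
  rw [mul_assoc, h.l_mul]

theorem mul_coeff (h : IsDysonSystem P A T l k) (n : ℕ) : P * (P * l n) = P * l n := by
  rw [← mul_assoc, h.idem]

theorem coeff_one (h : IsDysonSystem P A T l k) : P * l 1 = 0 := h.odd 0

variable [CompleteSpace X]

theorem continuousOn_convolution (h : IsDysonSystem P A T l k) {u : ℝ → X}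
    (hu : ContinuousOn u (Ici 0)) (t : ℝ) :
    ContinuousOn (fun s => P (T (t - s) (u s))) (Icc 0 t) :=
  P.continuous.comp_continuousOn (h.gen.1.continuousOn_apply (by fun_prop)
    (fun s hs => by linarith [hs.2]) (hu.mono Icc_subset_Ici_self))

theorem intervalIntegrable_convolution (h : IsDysonSystem P A T l k) {u : ℝ → X}
    (hu : ContinuousOn u (Ici 0)) {t : ℝ} (ht : 0 ≤ t) :
    IntervalIntegrable (fun s => P (T (t - s) (u s))) MeasureTheory.volume 0 t := by
  refine ContinuousOn.intervalIntegrable ?_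
  rw [uIcc_of_le ht]
  exact h.continuousOn_convolution hu t

theorem continuousOn_pow_apply (h : IsDysonSystem P A T l k) (n : ℕ) (x : X) :
    ContinuousOn (fun s => ((P * T s * P) ^ n) x) (Ici 0) := by
  induction n with
  | zero => simpa using continuousOn_const
  | succ n ih =>
    simp only [pow_succ']
    exact P.continuous.comp_continuousOn (h.gen.1.continuousOn_apply continuousOn_id
      (fun s hs => hs) (P.continuous.comp_continuousOn ih))

theorem continuousOn_sub_pow_apply (h : IsDysonSystem P A T l k) (n : ℕ) (x : X) :
    ContinuousOn (fun s => ((P * T s * P - P) ^ n) x) (Ici 0) := by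
  induction n with
  | zero => simpa using continuousOn_const
  | succ n ih =>
    simp only [pow_succ']
    exact (P.continuous.comp_continuousOn (h.gen.1.continuousOn_apply continuousOn_id
      (fun s hs => hs) (P.continuous.comp_continuousOn ih))).sub
      (P.continuous.comp_continuousOn ih)

variable [IsScalarTower ℝ 𝕜 X]

theorem hasExpansion_projected (h : IsDysonSystem P A T l k) :
    HasExpansion 𝕜 (fun t => P * T t * P) fun m => (m ! : 𝕜)⁻¹ • (P * l m) := by
  have := hasExpansion_iterate h.gen h.succ P 0
  simpa only [h.zero, zero_add] using this

theorem hasExpansion_sub (h : IsDysonSystem P A T l k) :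
    HasExpansion 𝕜 (fun t => P * T t * P - P) fun m =>
      PowerSeries.coeff m (expSeries 𝕜 fun n => P * l n) := by
  convert h.hasExpansion_projected.sub (hasExpansion_const P) using 2 with m
  rw [expSeries, PowerSeries.coeff_mk]
  split_ifs with hm
  · simp [hm, h.zero, h.idem]
  · simp

/-- Comparing coefficients in the Dyson identity gives `a (n+2) x = κ n + ∑_{j<n} a (n-j) (κ j)`,
which is the bipartition recursion shifted by two. -/
theorem iteratedDerivWithin_kernel (h : IsDysonSystem P A T l k) (m : ℕ) (x : X) :
    iteratedDerivWithin m (k x) (Ici 0) 0 = bipartition (fun n => P * l n) (m + 2) x := by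
  set κ : ℕ → X := fun m => iteratedDerivWithin m (k x) (Ici 0) 0
  have hk : HasExpansion 𝕜 (k x) fun m => (m ! : 𝕜)⁻¹ • κ m := hasExpansion_of_contDiffOn (h.smooth x)
  -- The kernel takes values in the range of `P`, and expansions are unique.
  have hPκ : ∀ m, P (κ m) = κ m := by
    intro m
    have h1 := congrFun (((hk.clm P).congr fun t _ => h.proj x t).unique hk) m
    simp only [map_smul] at h1
    exact smul_right_injective X (inv_ne_zero (Nat.cast_ne_zero.2 (Nat.factorial_ne_zero m))) h1
  have hkc : ContinuousOn (k x) (Ici 0) := (h.smooth x).continuousOn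
  -- Inserting `P` is free on the kernel; it makes the first factor `P T P`, whose expansion has the
  -- coefficients `a i`.
  have hpk : ∀ t s : ℝ, (P * T (t - s) * P) (k x s) = P (T (t - s) (k x s)) := by
    intro t s
    change P (T (t - s) (P (k x s))) = _
    rw [h.proj]
  have hleft := (hasExpansion_iterate h.gen h.succ P 1).clm (ContinuousLinearMap.apply 𝕜 X x)
  have hright := HasExpansion.convolution
    (c := fun n => Nat.casesOn n 0 fun n => ((n + 1)! : 𝕜)⁻¹ •
      ∑ q ∈ Finset.HasAntidiagonal.antidiagonal n, (P * l q.1) (κ q.2))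
    h.hasExpansion_projected hk
    (fun t ht => by simpa only [hpk] using h.intervalIntegrable_convolution hkc ht)
    rfl (fun n => rfl)
  have hcoeff := hleft.unique (hright.congr fun t ht => by
    simp only [hpk]
    exact (h.dyson x t ht).symm)
  have hrec : ∀ n, (P * l (n + 2)) x =
      κ n + ∑ j ∈ Finset.range n, (P * l (n - j)) (κ j) := by
    intro n
    have h1 := congrFun hcoeff (n + 1)
    simp only [ContinuousLinearMap.apply_apply, smul_apply] at h1
    have h2 := smul_right_injective X
      (inv_ne_zero (Nat.cast_ne_zero (R := 𝕜).2 (Nat.factorial_ne_zero (n + 1)))) h1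
    rw [show 1 + (n + 1) = n + 2 by ring] at h2
    rw [h2, ← Finset.Nat.sum_antidiagonal_swap,
      Finset.Nat.sum_antidiagonal_eq_sum_range_succ_mk, Finset.sum_range_succ, add_comm]
    congr 1
    simp only [Prod.swap, Nat.sub_self, h.zero]
    rw [h.idem, hPκ]
  have key : ∀ n, κ n = bipartition (fun n => P * l n) (n + 2) x := by
    intro n
    induction n using Nat.strong_induction_on with
    | _ n ih =>
      -- The summand containing `P̃ 1 = a 1` splits off and vanishes; the others match `hrec`.
      rw [bipartition_succ, Finset.sum_range_succ']
      simp only [zero_add, bipartition_succ _ 0, Finset.range_zero, Finset.sum_empty, sub_zero,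
        h.coeff_one, mul_zero, add_zero, sub_apply, sum_apply]
      rw [eq_sub_iff_add_eq, hrec]
      congr 1
      refine Finset.sum_congr rfl fun j hj => ?_
      rw [ih j (Finset.mem_range.1 hj), Nat.add_sub_add_right]
      rfl
  exact key m

theorem hasExpansion_kernel (h : IsDysonSystem P A T l k) (x : X) :
    HasExpansion 𝕜 (k x) fun m =>
      PowerSeries.coeff m (kernelSeries 𝕜 fun n => P * l n) x := by
  convert hasExpansion_of_contDiffOn (𝕜 := 𝕜) (h.smooth x) using 2 with m
  rw [h.iteratedDerivWithin_kernel]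
  simp [kernelSeries]

theorem derivWithin_projected (h : IsDysonSystem P A T l k) (x : X) {t : ℝ} (ht : 0 ≤ t) :
    derivWithin (projected P T x) (Ici 0) t = ∫ s in (0 : ℝ)..t, P (T (t - s) (k x s)) := by
  have := hasDerivWithinAt_iterate h.gen h.succ P 0 x ht
  simp only [h.zero] at this
  rw [← h.dyson x t ht]
  exact this.derivWithin (uniqueDiffOn_Ici 0 t ht)

theorem differentiableOn_projected (h : IsDysonSystem P A T l k) (x : X) :
    DifferentiableOn ℝ (projected P T x) (Ici 0) := by
  intro t ht
  have := hasDerivWithinAt_iterate h.gen h.succ P 0 x ht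
  simp only [h.zero] at this
  exact this.differentiableWithinAt

theorem expansionTerm_eq (h : IsDysonSystem P A T l k) {f : ℕ → X →L[𝕜] X}
    (hf : ∀ n, f n * P = f n) (n : ℕ) (x : X) {t : ℝ} (ht : 0 ≤ t) :
    expansionTerm P T (fun n => (n ! : 𝕜) • f n) n t x =
      ∫ s in (0 : ℝ)..t, P (T (t - s) ((f n * (P * T s * P - P) ^ n) x)) := by
  have hint : ∀ j ∈ Finset.range (n + 1), IntervalIntegrable (fun s : ℝ =>
      ((-1 : ℝ) ^ (n - j) / ((n - j)! * j !)) •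
        P (T (t - s) (((n ! : 𝕜) • f n) (((P * T s * P) ^ j) x)))) MeasureTheory.volume 0 t := by
    intro j _
    exact (h.intervalIntegrable_convolution (u := fun s => ((n ! : 𝕜) • f n)
      (((P * T s * P) ^ j) x)) (ContinuousLinearMap.continuous _ |>.comp_continuousOn
        (h.continuousOn_pow_apply j x)) ht).smul _
  rw [expansionTerm]
  simp only [← intervalIntegral.integral_smul]
  rw [← intervalIntegral.integral_finsetSum hint]
  refine intervalIntegral.integral_congr fun s _ => ?_
  have hp : P * T s * P * P = P * T s * P := by rw [mul_assoc, h.idem]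
  have e := mul_sub_one_pow_eq (hf n) h.idem hp n
  rw [← sum_smul_mul_pow (𝕜 := 𝕜)] at e
  simp only [← e, smul_mul_assoc, sum_apply, map_sum, smul_apply, map_smul,
    RCLike.real_smul_eq_coe_smul (K := 𝕜)]
  rfl

theorem derivWithin_sub_sum_expansionTerm (h : IsDysonSystem P A T l k) {f : ℕ → X →L[𝕜] X}
    (hf : ∀ n, f n * P = f n) (N : ℕ) (x : X) {t : ℝ} (ht : 0 ≤ t) :
    derivWithin (projected P T x) (Ici 0) t -
        ∑ n ∈ Finset.range N, expansionTerm P T (fun n => (n ! : 𝕜) • f n) n t x =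
      ∫ s in (0 : ℝ)..t, P (T (t - s) (k x s -
        ∑ n ∈ Finset.range N, (f n * (P * T s * P - P) ^ n) x)) := by
  have hc : ∀ n, ContinuousOn (fun s => (f n * (P * T s * P - P) ^ n) x) (Ici 0) := fun n =>
    (f n).continuous.comp_continuousOn (h.continuousOn_sub_pow_apply n x)
  rw [h.derivWithin_projected x ht, Finset.sum_congr rfl fun n _ => h.expansionTerm_eq hf n x ht,
    ← intervalIntegral.integral_finsetSum fun n _ => h.intervalIntegrable_convolution (hc n) ht,
    ← intervalIntegral.integral_sub
      (h.intervalIntegrable_convolution (h.smooth x).continuousOn ht)]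
  · simp only [map_sub, map_sum]
  · have := IntervalIntegrable.sum (Finset.range N)
      fun n _ => h.intervalIntegrable_convolution (hc n) ht
    simpa only [Finset.sum_fn] using this

end IsDysonSystem

end MoriZwanzigEquation

/-! ### Operator norm bounds from pointwise convergence. -/

section Bounds

/-- Summable terms are bounded for each `x`, hence uniformly in operator norm by the uniform
boundedness principle. -/
theorem exists_norm_coeff_le {𝕜 X : Type*} [RCLike 𝕜] [NormedAddCommGroup X] [NormedSpace 𝕜 X]
    [CompleteSpace X] {g : ℕ → X →L[𝕜] X} {t : ℝ} (ht : 0 < t)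
    (hg : ∀ x, Summable fun m => (t : 𝕜) ^ m • g m x) :
    ∃ C, 0 ≤ C ∧ ∀ m, ‖g m‖ ≤ C * t⁻¹ ^ m := by
  have h1 : ∀ x, ∃ C, ∀ m, ‖((t : 𝕜) ^ m • g m) x‖ ≤ C := by
    intro x
    obtain ⟨C, hC⟩ := (hg x).tendsto_atTop_zero.norm.bddAbove_range
    exact ⟨C, fun m => hC ⟨m, rfl⟩⟩
  obtain ⟨C, hC⟩ := banach_steinhaus h1
  refine ⟨C, (norm_nonneg _).trans (hC 0), fun m => ?_⟩
  have h2 := hC m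
  rw [norm_smul, norm_pow, RCLike.norm_ofReal, abs_of_pos ht] at h2
  have h3 : 0 < t ^ m := pow_pos ht m
  rw [inv_pow, ← div_eq_mul_inv, le_div_iff₀ h3]
  linarith

theorem exists_norm_coeff_cornerInverse_le {R : Type*} [NormedRing R] {A : PowerSeries R} {P : R}
    {u : Rˣ} {C r : ℝ} (hC : 0 ≤ C) (hr : 0 ≤ r)
    (hA : ∀ n, ‖PowerSeries.coeff n A‖ ≤ C * r ^ n) :
    ∃ D r', 0 ≤ D ∧ 0 ≤ r' ∧ ∀ n, ‖PowerSeries.coeff n (cornerInverse A P u)‖ ≤ D * r' ^ n := by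
  have h1 : ∀ n, ‖PowerSeries.coeff n (A + PowerSeries.C (1 - P))‖ ≤ (C + ‖1 - P‖) * r ^ n := by
    intro n
    rw [map_add, add_mul]
    refine (norm_add_le _ _).trans (add_le_add (hA n) ?_)
    rw [PowerSeries.coeff_C]
    split_ifs with hn
    · simp [hn]
    · rw [norm_zero]; positivity
  refine ⟨‖(↑u⁻¹ : R)‖ * ‖P‖, r * (1 + (C + ‖1 - P‖) * ‖(↑u⁻¹ : R)‖), by positivity, by positivity,
    fun n => ?_⟩
  rw [cornerInverse, PowerSeries.coeff_mul_C]
  refine (norm_mul_le _ _).trans ?_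
  rw [mul_right_comm]
  exact mul_le_mul_of_nonneg_right
    (norm_coeff_invOfUnit_le (by positivity) hr h1 u n) (norm_nonneg _)

end Bounds

/-! ### The expansion to all orders and its convergence. -/

section Expansion

variable {𝕜 X : Type*} [RCLike 𝕜] [NormedAddCommGroup X] [NormedSpace ℝ X] [NormedSpace 𝕜 X]
  {P : X →L[𝕜] X} {A : X →ₗ.[𝕜] X} {T : ℝ → X →L[𝕜] X} {l : ℕ → X →L[𝕜] X}
  {k : X → ℝ → X}

namespace IsDysonSystem

/-- The unit `1 - P + A²P / 2`. -/
noncomputable def unit (h : IsDysonSystem P A T l k) {b : X →L[𝕜] X} (hPb : P * b = b)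
    (hbP : b * P = b) (hab : P * l 2 * b = P) (hba : b * (P * l 2) = P) : (X →L[𝕜] X)ˣ :=
  cornerUnit 𝕜 P (P * l 2) b h.idem (h.mul_coeff 2) (h.coeff_mul 2) hPb hbP hab hba

/-- `E` is the inverse of the generating series of `P Aⁿ P`, `n ≥ 2`, divided by `X ^ 2`. -/
structure IsDivisor (P : X →L[𝕜] X) (l : ℕ → X →L[𝕜] X) (E : PowerSeries (X →L[𝕜] X)) :
    Prop where
  even : IsEvenSeries E
  mul_C : E * PowerSeries.C P = E
  mul_shift : E * shiftTwo (expSeries 𝕜 fun n => P * l n) = PowerSeries.C P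

theorem isDivisor_cornerInverse (h : IsDysonSystem P A T l k) {b : X →L[𝕜] X} (hPb : P * b = b)
    (hbP : b * P = b) (hab : P * l 2 * b = P) (hba : b * (P * l 2) = P) :
    IsDivisor P l (cornerInverse (shiftTwo (expSeries 𝕜 fun n => P * l n)) P
      (h.unit hPb hbP hab hba)) where
  even := (shiftTwo_expSeries_isEven h.odd).cornerInverse
  mul_C := cornerInverse_mul_C h.idem
  mul_shift := by
    refine cornerInverse_mul h.idem ?_ ?_ ?_
    · ext1 m
      simp [shiftTwo, expSeries, PowerSeries.coeff_C_mul, h.mul_coeff]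
    · ext1 m
      simp [shiftTwo, expSeries, PowerSeries.coeff_mul_C, h.coeff_mul]
    · rw [add_comm]
      simp [shiftTwo, expSeries, unit, cornerUnit]

variable {E : PowerSeries (X →L[𝕜] X)}

/-- The coefficients `F n / n!` of the expansion of the memory kernel. -/
noncomputable def expansionCoeff (l : ℕ → X →L[𝕜] X) (P : X →L[𝕜] X)
    (E : PowerSeries (X →L[𝕜] X)) (n : ℕ) : X →L[𝕜] X :=
  PowerSeries.coeff 0 (quotient E (kernelSeries 𝕜 fun n => P * l n) n)

theorem expansionCoeff_mul (h : IsDysonSystem P A T l k) (hE : IsDivisor P l E) (n : ℕ) :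
    expansionCoeff l P E n * P = expansionCoeff l P E n := by
  have := congrArg (PowerSeries.coeff 0)
    (quotient_mul_C hE.mul_C (kernelSeries_mul_C (𝕜 := 𝕜) (a := fun n => P * l n) h.coeff_mul) n)
  rwa [PowerSeries.coeff_mul_C] at this

theorem kernelSeries_eq_sum (h : IsDysonSystem P A T l k) (hE : IsDivisor P l E) (N : ℕ) :
    kernelSeries 𝕜 (fun n => P * l n) = ∑ n ∈ Finset.range N,
      PowerSeries.C (expansionCoeff l P E n) * (expSeries 𝕜 fun n => P * l n) ^ n +
        quotient E (kernelSeries 𝕜 fun n => P * l n) N * (expSeries 𝕜 fun n => P * l n) ^ N := by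
  have := eq_sum_quotient hE.even (kernelSeries_isEven (𝕜 := 𝕜) h.odd) hE.mul_C
    (kernelSeries_mul_C h.coeff_mul) hE.mul_shift N
  rwa [← expSeries_eq (𝕜 := 𝕜) (a := fun n => P * l n) h.coeff_one] at this

variable [CompleteSpace X] [IsScalarTower ℝ 𝕜 X]

/-- The formal remainder has no coefficients below degree `2N`, so the kernel and the partial sum
share theirs up to that degree. -/
theorem isBigO_kernel_sub_sum (h : IsDysonSystem P A T l k) (hE : IsDivisor P l E) (N : ℕ)
    (x : X) : (fun s => k x s -
      ∑ n ∈ Finset.range N, (expansionCoeff l P E n * (P * T s * P - P) ^ n) x)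
      =O[𝓝[≥] 0] fun t : ℝ => t ^ (2 * N) := by
  have h1 : HasExpansion 𝕜 (fun s => ∑ n ∈ Finset.range N,
      (expansionCoeff l P E n * (P * T s * P - P) ^ n) x) fun m => ∑ n ∈ Finset.range N,
        (expansionCoeff l P E n *
          PowerSeries.coeff m ((expSeries 𝕜 fun n => P * l n) ^ n)) x :=
    HasExpansion.sum _ fun n _ =>
      ((h.hasExpansion_sub.pow n).clm (ContinuousLinearMap.apply 𝕜 X x)).clm
        (expansionCoeff l P E n)
  refine ((h.hasExpansion_kernel x).sub h1 (2 * N)).congr_left fun t => ?_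
  rw [Finset.sum_eq_zero, sub_zero]
  intro m hm
  have h2 := congrArg (PowerSeries.coeff m) (h.kernelSeries_eq_sum hE N)
  rw [expSeries_eq (𝕜 := 𝕜) (a := fun n => P * l n) h.coeff_one, map_add,
    coeff_mul_X_sq_mul_pow_of_lt _ _ (Finset.mem_range.1 hm), add_zero,
    ← expSeries_eq (𝕜 := 𝕜) (a := fun n => P * l n) h.coeff_one, map_sum] at h2
  simp only [PowerSeries.coeff_C_mul] at h2
  simp only [h2, sum_apply, sub_self, smul_zero]

theorem isBigO_dyson_sub_sum (h : IsDysonSystem P A T l k) (hE : IsDivisor P l E) (N : ℕ)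
    (x : X) : (fun t => derivWithin (projected P T x) (Ici 0) t - ∑ n ∈ Finset.range N,
      expansionTerm P T (fun n => (n ! : 𝕜) • expansionCoeff l P E n) n t x)
      =O[𝓝[≥] 0] fun t : ℝ => t ^ (2 * N + 1) := by
  obtain ⟨ε, hε, C, hC, h1⟩ := isBigO_nhdsGE_pow_iff.1 (h.isBigO_kernel_sub_sum hE N x)
  obtain ⟨M, hM0, hM⟩ := h.gen.1.exists_norm_le ε
  refine (isBigO_integral_nhdsGE (g := fun t s => P (T (t - s) (k x s -
    ∑ n ∈ Finset.range N, (expansionCoeff l P E n * (P * T s * P - P) ^ n) x)))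
    (C := ‖P‖ * (M * C)) hε fun t ht s hs => ?_).congr' ?_ EventuallyEq.rfl
  · have h2 := h1 s ⟨hs.1, hs.2.trans ht⟩
    have h3 : C * s ^ (2 * N) ≤ C * t ^ (2 * N) := by
      have := hs.1
      have := hs.2
      gcongr
    rw [mul_assoc ‖P‖, mul_assoc M]
    exact P.le_opNorm_of_le ((T (t - s)).le_of_opNorm_le_of_le
      (hM _ ⟨by linarith [hs.2], by linarith [hs.1]⟩) (h2.trans h3))
  · filter_upwards [self_mem_nhdsWithin] with t ht
    exact (h.derivWithin_sub_sum_expansionTerm (h.expansionCoeff_mul hE) N x ht).symm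

theorem exists_hasSum_expansionTerm (h : IsDysonSystem P A T l k) (hE : IsDivisor P l E)
    {r C₁ C₂ r₀ D r₁ : ℝ} (hr : 0 < r) (hC₁ : 0 ≤ C₁) (hC₂ : 0 ≤ C₂) (hD : 0 ≤ D) (hr₀ : 0 < r₀)
    (ha : ∀ m, ‖PowerSeries.coeff m (expSeries 𝕜 fun n => P * l n)‖ ≤ C₁ * r₀ ^ m)
    (hK : ∀ m, ‖PowerSeries.coeff m (kernelSeries 𝕜 fun n => P * l n)‖ ≤ C₂ * r₀ ^ m)
    (hr₁ : 0 ≤ r₁) (hEn : ∀ m, ‖PowerSeries.coeff m E‖ ≤ D * r₁ ^ m)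
    (hp : ∀ x, ∀ t ∈ Ico 0 r, HasSum (fun m : ℕ =>
      (t : 𝕜) ^ m • PowerSeries.coeff m (expSeries 𝕜 fun n => P * l n) x)
      ((P * T t * P - P) x))
    (hk : ∀ x, ∀ t ∈ Ico 0 r, HasSum (fun m : ℕ =>
      (t : 𝕜) ^ m • PowerSeries.coeff m (kernelSeries 𝕜 fun n => P * l n) x) (k x t)) :
    ∃ δ > 0, ∀ x : X, ∀ t ∈ Ico 0 δ, HasSum (fun n =>
      expansionTerm P T (fun n => (n ! : 𝕜) • expansionCoeff l P E n) n t x)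
      (derivWithin (projected P T x) (Ici 0) t) := by
  set W := expSeries 𝕜 fun n => P * l n
  set K := kernelSeries 𝕜 fun n => P * l n
  -- The factor `2` gives `E` the rate `R / 2` required by the bound on the quotients.
  set R := 2 * max r₀ r₁
  have hR : 0 < R := by positivity
  have hr₀R : r₀ ≤ R := by
    have := le_max_left r₀ r₁
    linarith
  have hWR : ∀ m, ‖PowerSeries.coeff m W‖ ≤ C₁ * R ^ m := fun m =>
    (ha m).trans (by gcongr)
  have hKR : ∀ m, ‖PowerSeries.coeff m K‖ ≤ C₂ * R ^ m := fun m =>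
    (hK m).trans (by gcongr)
  have hER : ∀ m, ‖PowerSeries.coeff m E‖ ≤ D * (R / 2) ^ m := fun m =>
    (hEn m).trans (by
      have : r₁ ≤ R / 2 := by
        have := le_max_right r₀ r₁
        simp only [R]; linarith
      gcongr)
  have hquot := norm_coeff_quotient_le hC₂ hD hR.le hER hKR
  set ρ := 2 * D * R ^ 2
  have hρ : 0 ≤ ρ := by positivity
  obtain ⟨ε, hε, C₃, hC₃, hw⟩ := isBigO_nhdsGE_pow_iff.1 (h.hasExpansion_sub 1)
  have hw' : ∀ s ∈ Icc 0 ε, ‖P * T s * P - P‖ ≤ C₃ * s := by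
    intro s hs
    have h1 := hw s hs
    simp only [Finset.sum_range_one, expSeries, PowerSeries.coeff_mk, if_true, smul_zero, sub_zero,
      pow_one] at h1
    exact h1
  obtain ⟨M, hM0, hM⟩ := h.gen.1.exists_norm_le 1
  -- The bounds serve, in order: ratio `1/2` in all power series, the estimate `‖w(s)‖ ≤ C₃ s`, the
  -- inequality `ρ ‖w(s)‖ ≤ 1/2`, validity of the Taylor series, and a semigroup bound on an
  -- interval of length at most `1`.
  set δ := min (min (1 / (2 * R)) ε) (min (1 / (2 * (ρ * C₃ + 1))) (min r 1))
  have hδ : 0 < δ := by positivity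
  have d1 : δ ≤ 1 / (2 * R) := (min_le_left _ _).trans (min_le_left _ _)
  have d2 : δ ≤ ε := (min_le_left _ _).trans (min_le_right _ _)
  have d3 : δ ≤ 1 / (2 * (ρ * C₃ + 1)) := (min_le_right _ _).trans (min_le_left _ _)
  have d4 : δ ≤ r := (min_le_right _ _).trans ((min_le_right _ _).trans (min_le_left _ _))
  have d5 : δ ≤ 1 := (min_le_right _ _).trans ((min_le_right _ _).trans (min_le_right _ _))
  have hsR : ∀ s ∈ Ico 0 δ, s * R ≤ 1 / 2 := by
    intro s hs
    have := (le_div_iff₀ (by positivity)).1 (hs.2.le.trans d1)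
    linarith
  have hρw : ∀ s ∈ Ico 0 δ, ρ * ‖P * T s * P - P‖ ≤ 1 / 2 := by
    intro s hs
    have h1 := hw' s ⟨hs.1, hs.2.le.trans d2⟩
    have h2 := (le_div_iff₀ (by positivity)).1 (hs.2.le.trans d3)
    have h3 : ρ * ‖P * T s * P - P‖ ≤ ρ * (C₃ * s) := by gcongr
    have := hs.1
    nlinarith
  have hWs : ∀ s ∈ Ico 0 δ, evalSeries 𝕜 W s = P * T s * P - P := by
    intro s hs
    ext x
    have h1 := (summable_norm_evalSeries (𝕜 := 𝕜) hs.1 hR.le hC₁ (hsR s hs) hWR).of_norm.hasSum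
    have h2 := (ContinuousLinearMap.apply 𝕜 X x).hasSum h1
    exact h2.unique (hp x s ⟨hs.1, hs.2.trans_le d4⟩)
  have hKs : ∀ s ∈ Ico 0 δ, ∀ x, evalSeries 𝕜 K s x = k x s := by
    intro s hs x
    have h1 := (summable_norm_evalSeries (𝕜 := 𝕜) hs.1 hR.le hC₂ (hsR s hs) hKR).of_norm.hasSum
    have h2 := (ContinuousLinearMap.apply 𝕜 X x).hasSum h1
    exact h2.unique (hk x s ⟨hs.1, hs.2.trans_le d4⟩)
  -- Dividing one step at a time requires only products of a quotient with `W`, for which absolute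
  -- convergence is known.
  have hqs : ∀ s ∈ Ico 0 δ, ∀ N, evalSeries 𝕜 K s =
      ∑ n ∈ Finset.range N, expansionCoeff l P E n * (P * T s * P - P) ^ n +
        evalSeries 𝕜 (quotient E K N) s * (P * T s * P - P) ^ N := by
    intro s hs N
    induction N with
    | zero => simp [quotient]
    | succ N ih =>
      have h1 := quotient_eq_C_add hE.even (kernelSeries_isEven (𝕜 := 𝕜) h.odd) hE.mul_C
        (kernelSeries_mul_C h.coeff_mul) hE.mul_shift N
      rw [← expSeries_eq (𝕜 := 𝕜) (a := fun n => P * l n) h.coeff_one] at h1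
      have h2 := evalSeries_mul (𝕜 := 𝕜)
        (summable_norm_evalSeries (𝕜 := 𝕜) hs.1 hR.le (by positivity) (hsR s hs) (hquot (N + 1)))
        (summable_norm_evalSeries (𝕜 := 𝕜) hs.1 hR.le hC₁ (hsR s hs) hWR)
      have h3 : evalSeries 𝕜 (quotient E K N) s = expansionCoeff l P E N +
          evalSeries 𝕜 (quotient E K (N + 1)) s * (P * T s * P - P) := by
        rw [← hWs s hs, ← h2.1, ← evalSeries_C_add h2.2]
        exact congrArg (fun B => evalSeries 𝕜 B s) h1
      rw [ih, h3, Finset.sum_range_succ, pow_succ' _ N, add_mul,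
          mul_assoc (evalSeries 𝕜 _ s), add_assoc]
  have hf : ∀ n, ‖expansionCoeff l P E n‖ ≤ C₂ * ρ ^ n := fun n => by
    simpa [expansionCoeff] using hquot n 0
  have hgeom : ∀ s ∈ Ico 0 δ, ∀ (B : X →L[𝕜] X) (C : ℝ) (n : ℕ), 0 ≤ C → ‖B‖ ≤ C * ρ ^ n →
      ‖B * (P * T s * P - P) ^ n‖ ≤ C * (1 / 2) ^ n := by
    intro s hs B C n hC hB
    refine (norm_mul_pow_le _ _ _).trans ?_
    calc ‖B‖ * ‖P * T s * P - P‖ ^ n ≤ C * ρ ^ n * ‖P * T s * P - P‖ ^ n := by gcongr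
      _ = C * (ρ * ‖P * T s * P - P‖) ^ n := by ring
      _ ≤ C * (1 / 2) ^ n := by
        have := hρw s hs
        gcongr
  have hint : ∀ t ∈ Ico 0 δ, ∀ (B : ℝ → X →L[𝕜] X) (C : ℝ) (x : X),
      (∀ s ∈ Icc 0 t, ‖B s‖ ≤ C) →
      ‖∫ s in (0 : ℝ)..t, P (T (t - s) (B s x))‖ ≤ ‖P‖ * (M * (C * ‖x‖)) := by
    intro t ht B C x hB
    have hC0 : 0 ≤ C := (norm_nonneg _).trans (hB 0 ⟨le_rfl, ht.1⟩)
    refine (intervalIntegral.norm_integral_le_of_norm_le_const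
      (C := ‖P‖ * (M * (C * ‖x‖))) fun s hs => ?_).trans ?_
    · rw [uIoc_of_le ht.1] at hs
      have := ht.2
      exact P.le_opNorm_of_le ((T (t - s)).le_of_opNorm_le_of_le
        (hM _ ⟨by linarith [hs.2], by linarith [hs.1]⟩)
        ((B s).le_of_opNorm_le (hB s ⟨hs.1.le, hs.2⟩) x))
    · rw [sub_zero, abs_of_nonneg ht.1]
      exact mul_le_of_le_one_right (by positivity) (ht.2.le.trans d5)
  refine ⟨δ, hδ, fun x t ht => ?_⟩
  have hsub : ∀ s ∈ Icc 0 t, s ∈ Ico 0 δ := fun s hs => ⟨hs.1, hs.2.trans_lt ht.2⟩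
  have hsummable : Summable fun n =>
      expansionTerm P T (fun n => (n ! : 𝕜) • expansionCoeff l P E n) n t x := by
    refine Summable.of_norm_bounded
      (g := fun n => ‖P‖ * (M * (C₂ * (1 / 2 : ℝ) ^ n * ‖x‖))) ?_ fun n => ?_
    · exact (((summable_geometric_two.mul_left C₂).mul_right ‖x‖).mul_left M).mul_left ‖P‖
    · rw [h.expansionTerm_eq (h.expansionCoeff_mul hE) n x ht.1]
      exact hint t ht _ _ x fun s hs => hgeom s (hsub s hs) _ _ n hC₂ (hf n)
  refine (hsummable.hasSum_iff_tendsto_nat).2 ?_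
  rw [tendsto_iff_norm_sub_tendsto_zero]
  have hlim : Tendsto (fun N : ℕ => ‖P‖ * (M * (2 * C₂ * (1 / 2 : ℝ) ^ N * ‖x‖))) atTop (𝓝 0) := by
    have h1 := tendsto_pow_atTop_nhds_zero_of_lt_one (r := (1 / 2 : ℝ)) (by norm_num) (by norm_num)
    simpa using (((h1.const_mul (2 * C₂)).mul_const ‖x‖).const_mul M).const_mul ‖P‖
  refine squeeze_zero (fun _ => norm_nonneg _) (fun N => ?_) hlim
  rw [norm_sub_rev, h.derivWithin_sub_sum_expansionTerm (h.expansionCoeff_mul hE) N x ht.1]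
  have h1 : ∫ s in (0 : ℝ)..t, P (T (t - s) (k x s -
        ∑ n ∈ Finset.range N, (expansionCoeff l P E n * (P * T s * P - P) ^ n) x)) =
      ∫ s in (0 : ℝ)..t, P (T (t - s)
        ((evalSeries 𝕜 (quotient E K N) s * (P * T s * P - P) ^ N) x)) := by
    refine intervalIntegral.integral_congr fun s hs => ?_
    rw [uIcc_of_le ht.1] at hs
    have h2 := hKs s (hsub s hs) x
    rw [hqs s (hsub s hs) N, add_apply, sum_apply] at h2
    simp only [← h2, add_sub_cancel_left]
  rw [h1]
  refine hint t ht _ _ x fun s hs => hgeom s (hsub s hs) _ _ N (by positivity) ?_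
  have h3 := norm_evalSeries_le (𝕜 := 𝕜) hs.1 hR.le (by positivity) (hsR s (hsub s hs)) (hquot N)
  refine h3.trans_eq (by ring)

end IsDysonSystem

end Expansion

/-! ### Bounded inverse of `a 2` in the corner of `P`. -/

section CornerInverse

variable {𝕜 X : Type*} [RCLike 𝕜] [NormedAddCommGroup X] [NormedSpace 𝕜 X]

/-- Both `v` and `P v` lie in `V` and have the same image under `a`, which is injective there. Hence
`V` is exactly the range of `P`. -/
theorem IsInverseOn.apply_eq_self {P a : X →L[𝕜] X} (haP : a * P = a)
    {V : Submodule 𝕜 X} (hV : LinearMap.range (P : X →ₗ[𝕜] X) ≤ V) {J : Module.End 𝕜 V}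
    (hJ : IsInverseOn V (a : X →ₗ[𝕜] X) J) {v : X} (hv : v ∈ V) : P v = v := by
  have h1 := hJ.2.2 ⟨v, hv⟩ ⟨a v, hJ.1 v hv⟩ rfl
  have h2 := hJ.2.2 ⟨P v, hV ⟨v, rfl⟩⟩ ⟨a v, hJ.1 v hv⟩
    (congrArg (fun B : X →L[𝕜] X => B v) haP)
  exact congrArg Subtype.val (h2.symm.trans h1)

/-- The inverse is `J` after `P`. Its graph is closed because `a` and `P` are continuous and `V` is
the fixed space of `P`, so it is bounded even though `J` is only assumed linear. -/
theorem IsInverseOn.exists_cornerInverse [CompleteSpace X] {P a : X →L[𝕜] X} (hP : P * P = P)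
    (haP : a * P = a) {V : Submodule 𝕜 X} (hV : LinearMap.range (P : X →ₗ[𝕜] X) ≤ V)
    {J : Module.End 𝕜 V} (hJ : IsInverseOn V (a : X →ₗ[𝕜] X) J) :
    ∃ b : X →L[𝕜] X, P * b = b ∧ b * P = b ∧ a * b = P ∧ b * a = P := by
  have hPV : ∀ {v}, v ∈ V → P v = v := fun hv => hJ.apply_eq_self haP hV hv
  have hPP : ∀ x, P (P x) = P x := fun x => congrArg (fun B : X →L[𝕜] X => B x) hP
  have haP' : ∀ x, a (P x) = a x := fun x => congrArg (fun B : X →L[𝕜] X => B x) haP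
  let m : X →ₗ[𝕜] X := V.subtype ∘ₗ J ∘ₗ (P : X →ₗ[𝕜] X).codRestrict V fun x => hV ⟨x, rfl⟩
  have hmV : ∀ x, m x ∈ V := fun x => (J _).2
  have ham : ∀ x, a (m x) = P x := fun x => hJ.2.1 ⟨P x, hV ⟨x, rfl⟩⟩
  have hm : ∀ v ∈ V, ∀ x, a v = P x → m x = v := fun v hv x h =>
    congrArg Subtype.val (hJ.2.2 ⟨v, hv⟩ ⟨P x, hV ⟨x, rfl⟩⟩ h)
  have hcont : Continuous m := by
    refine m.continuous_of_seq_closed_graph fun u x y hu hy => ?_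
    have h1 : a y = P x := by
      refine tendsto_nhds_unique ((a.continuous.tendsto y).comp hy) ?_
      simpa only [Function.comp_def, ham] using (P.continuous.tendsto x).comp hu
    have h2 : P y = y := by
      refine tendsto_nhds_unique ((P.continuous.tendsto y).comp hy) ?_
      simpa only [Function.comp_def, hPV (hmV _)] using hy
    exact (hm y (h2 ▸ hV ⟨y, rfl⟩) x h1).symm
  refine ⟨⟨m, hcont⟩, ?_, ?_, ?_, ?_⟩
  · ext x
    exact hPV (hmV x)
  · ext x
    exact hm _ (hmV x) (P x) (by rw [ham, hPP])
  · ext x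
    exact ham x
  · ext x
    refine hm (P x) (hV ⟨x, rfl⟩) (a x) ?_
    rw [haP']
    have h1 : a (P x) ∈ V := hJ.1 _ (hV ⟨x, rfl⟩)
    rw [haP'] at h1
    exact (hPV h1).symm

end CornerInverse

/-! ### Uniqueness and the recursion of even order. -/

section Algebra

variable {𝕜 R : Type*} [RCLike 𝕜] [Ring R] [Algebra 𝕜 R]

theorem bipartition_two {R : Type*} [Ring R] (a : ℕ → R) : bipartition a 2 = a 2 - a 1 ^ 2 := by
  rw [bipartition_succ, Finset.sum_range_one, bipartition_succ a 0, Finset.sum_range_zero, sub_zero,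
    sq]

theorem pow_mul_pow_eq {a P b : R} (hPb : P * b = b) (hab : a * b = P) {n : ℕ} (hn : 1 ≤ n) :
    a ^ n * b ^ n = P := by
  induction n, hn using Nat.le_induction with
  | base => simpa using hab
  | succ n _ ih =>
    rw [pow_succ' a, pow_succ b, mul_assoc, ← mul_assoc (a ^ n), ih, hPb, hab]

/-- In the equation of order `2n` the terms `k > n` vanish and those with `k < n` agree by
induction. What remains is `(G n - F n) a 2 ^ n = 0`, and multiplying by `b ^ n` leaves `(G n - F n)
P = 0`. -/
theorem solvesWordEquation_unique {a F G : ℕ → R} {P b : R} (h1 : a 1 = 0) (hPb : P * b = b)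
    (hab : a 2 * b = P) (hF : SolvesWordEquation 𝕜 a F) (hFP : ∀ n, F n * P = F n)
    (hG : SolvesWordEquation 𝕜 a G) (hGP : ∀ n, G n * P = G n) (n : ℕ) : G n = F n := by
  induction n using Nat.strong_induction_on with
  | _ n ih =>
    rcases Nat.eq_zero_or_pos n with rfl | hn
    · rw [hF.1, hG.1]
    have h2 := (hG.2 (2 * n) (by omega)).symm.trans (hF.2 (2 * n) (by omega))
    rw [← sub_eq_zero, ← Finset.sum_sub_distrib, Finset.sum_eq_single n] at h2
    · have hc : (((2 * n)! : 𝕜) / (n ! * 2 ^ n : 𝕜)) ≠ 0 :=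
        div_ne_zero (Nat.cast_ne_zero.2 (Nat.factorial_ne_zero _))
          (mul_ne_zero (Nat.cast_ne_zero.2 (Nat.factorial_ne_zero _))
            (pow_ne_zero _ two_ne_zero))
      rw [← sub_mul, bellII_two_mul_self h1, mul_smul_comm, smul_eq_zero_iff_right hc] at h2
      have h3 := congrArg (fun x => x * b ^ n) h2
      simp only [mul_assoc, zero_mul] at h3
      rw [pow_mul_pow_eq hPb hab hn, sub_mul, hGP, hFP] at h3
      exact sub_eq_zero.1 h3
    · intro m hm hmn
      rcases lt_or_gt_of_ne hmn with h | h
      · rw [ih m h, sub_self]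
      · rw [bellII_eq_zero_of_lt h1 (by omega), mul_zero, mul_zero, sub_zero]
    · intro h
      exact absurd (Finset.mem_Icc.2 ⟨hn, by omega⟩) h

theorem bipartition_sub_sum_eq {a F : ℕ → R} (h1 : a 1 = 0) (hF : SolvesWordEquation 𝕜 a F)
    {n : ℕ} (hn : 1 ≤ n) :
    ((n ! * 2 ^ n : 𝕜) / ((2 * n)! : 𝕜)) •
      (bipartition a (2 * n + 2) - ∑ k ∈ Finset.Ico 1 n, F k * bellII 𝕜 a (2 * n) k) =
      F n * a 2 ^ n := by
  have h2 : ∑ k ∈ Finset.Icc 1 (2 * n), F k * bellII 𝕜 a (2 * n) k =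
      ∑ k ∈ Finset.Icc 1 n, F k * bellII 𝕜 a (2 * n) k := by
    refine (Finset.sum_subset (Finset.Icc_subset_Icc_right (by omega)) fun k hk hkn => ?_).symm
    rw [Finset.mem_Icc] at hk hkn
    rw [bellII_eq_zero_of_lt h1 (by omega), mul_zero]
  have hn1 : ((2 * n)! : 𝕜) ≠ 0 := Nat.cast_ne_zero.2 (Nat.factorial_ne_zero _)
  have hn2 : (n ! * 2 ^ n : 𝕜) ≠ 0 :=
    mul_ne_zero (Nat.cast_ne_zero.2 (Nat.factorial_ne_zero _)) (pow_ne_zero _ two_ne_zero)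
  rw [hF.2 (2 * n) (by omega), h2, ← Finset.Ico_insert_right hn,
    Finset.sum_insert (by simp), add_sub_cancel_right, bellII_two_mul_self h1, mul_smul_comm,
    smul_smul, div_mul_div_cancel₀ hn1, div_self hn2, one_smul]

theorem SolvesWordEquation.map {S : Type*} [Ring S] [Algebra 𝕜 S] (f : R →ₐ[𝕜] S)
    {a F : ℕ → R} (h : SolvesWordEquation 𝕜 a F) :
    SolvesWordEquation 𝕜 (fun n => f (a n)) fun n => f (F n) := by
  refine ⟨(congrArg f h.1).trans (by simp), fun n hn => ?_⟩
  have := map_bipartition (f : R →+* S) a (n + 2)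
  simp only [AlgHom.coe_toRingHom] at this
  rw [this, h.2 n hn, map_sum]
  simp only [map_mul, map_bellII]

end Algebra

/-! ### Assembling the hypotheses. -/

section Kernel

variable {𝕜 X : Type*} [RCLike 𝕜] [NormedAddCommGroup X] [NormedSpace ℝ X] [NormedSpace 𝕜 X]
  {P : X →L[𝕜] X} {A : X →ₗ.[𝕜] X} {T : ℝ → X →L[𝕜] X} {l : ℕ → X →L[𝕜] X}
  {k : X → ℝ → X}

theorem IsDysonSystem.solvesWordEquation (h : IsDysonSystem P A T l k)
    {E : PowerSeries (X →L[𝕜] X)} (hE : IsDysonSystem.IsDivisor P l E) :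
    SolvesWordEquation 𝕜 (fun n => P * l n)
      fun n => (n ! : 𝕜) • IsDysonSystem.expansionCoeff l P E n := by
  refine ⟨?_, fun n hn => bipartition_eq_sum (𝕜 := 𝕜) h.coeff_one h.odd h.coeff_mul hE.even
    hE.mul_C hE.mul_shift hn⟩
  simp only [IsDysonSystem.expansionCoeff, quotient, kernelSeries, PowerSeries.coeff_mk]
  rw [← bipartition_two (fun n => P * l n)]
  simp

variable (𝕜 X) in
/-- The inclusion of the bounded operators into the everywhere defined operators. -/
def toEndAlgHom : (X →L[𝕜] X) →ₐ[𝕜] Module.End 𝕜 X :=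
  { ContinuousLinearMap.toLinearMapRingHom with commutes' := fun _ => rfl }

variable [IsScalarTower ℝ 𝕜 X] [CompleteSpace X]

theorem isDysonSystem_memoryKernel {P Q : X →L[𝕜] X} (hPQ : P + Q = 1) (hPQ0 : P * Q = 0)
    {L : X →ₗ.[𝕜] X} {T S : ℝ → X →L[𝕜] X} (hL : L.IsClosable) (hT : Generates L.closure T)
    (hQL : ((Q : X →ₗ[𝕜] X).compPMap L).IsClosable)
    (hS : Generates ((Q : X →ₗ[𝕜] X).compPMap L).closure S) {l : ℕ → X →L[𝕜] X}
    (hl0 : l 0 = P) (hl : ∀ n x, (l n x, l (n + 1) x) ∈ L.closure.graph)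
    (hodd : ∀ j, P * l (2 * j + 1) = 0)
    (hmem : ∀ x : X, ∀ t : ℝ, 0 ≤ t → S t (Q (pval L.closure (P x))) ∈ L.closure.domain)
    (hsmooth : ∀ x : X, ContDiffOn ℝ ∞ (memoryKernel P Q L.closure S x) (Ici 0)) :
    IsDysonSystem P L.closure T l (memoryKernel P Q L.closure S) := by
  have hP : P * P = P := by
    have := congrArg (fun B => P * B) hPQ
    simpa [mul_add, hPQ0] using this
  have hPP : ∀ x, P (P x) = P x := fun x => congrArg (fun B : X →L[𝕜] X => B x) hP
  have hval : ∀ x, pval L.closure (P x) = l 1 x := fun x => pval_eq (hl0 ▸ hl 0 x)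
  refine ⟨hP, hT, hl0, hl, hodd, hsmooth, fun x t => hPP _, fun x t ht => ?_⟩
  -- As `P L P = 0`, the initial vector `Q L P x` of the kernel is `L P x` itself.
  have h1 : Q (l 1 x) = l 1 x := by
    have h2 := congrArg (fun B : X →L[𝕜] X => B (l 1 x)) hPQ
    have h3 : P (l 1 x) = 0 := congrArg (fun B : X →L[𝕜] X => B x) (hodd 0)
    simpa [h3] using h2
  have h2 : P (Q (pval L.closure (P x))) = 0 :=
    congrArg (fun B : X →L[𝕜] X => B (pval L.closure (P x))) hPQ0
  have h3 := dyson hPQ hPQ0 hL hT hQL hS h2 (hmem x) (hsmooth x).continuousOn ht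
  rw [hval x, h1] at h3
  rw [h3]
  simp only [memoryKernel, hval, h1]

theorem IsDysonSystem.exists_hasSum_of_taylorConverges (h : IsDysonSystem P A T l k)
    {b : X →L[𝕜] X} (hPb : P * b = b) (hbP : b * P = b) (hab : P * l 2 * b = P)
    (hba : b * (P * l 2) = P) {E : PowerSeries (X →L[𝕜] X)}
    (hE : E = cornerInverse (shiftTwo (expSeries 𝕜 fun n => P * l n)) P
      (h.unit hPb hbP hab hba)) {r : ℝ} (hr : 0 < r)
    (hp : TaylorConverges (projected P T) r) (hk : TaylorConverges k r) :
    ∃ δ > 0, ∀ x : X, ∀ t ∈ Ico 0 δ, HasSum (fun n =>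
      expansionTerm P T (fun n => (n ! : 𝕜) • IsDysonSystem.expansionCoeff l P E n) n t x)
      (derivWithin (projected P T x) (Ici 0) t) := by
  have hp' : ∀ x, ∀ t ∈ Ico 0 r, HasSum (fun m : ℕ =>
      (t : 𝕜) ^ m • PowerSeries.coeff m (expSeries 𝕜 fun n => P * l n) x)
      ((P * T t * P - P) x) := by
    intro x t ht
    refine ((hp x t ht).sub (hasSum_ite_eq (0 : ℕ) (P x))).congr_fun fun m => ?_
    rw [iteratedDerivWithin_projected h.gen h.zero h.succ m x le_rfl,
      ← coe_pow_smul_inv_factorial_smul (𝕜 := 𝕜), h.gen.1.zero, expSeries, PowerSeries.coeff_mk]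
    have := congrArg (fun B : X →L[𝕜] X => B x) h.idem
    split_ifs with hm
    · subst hm
      simpa [h.zero] using (sub_eq_zero.2 this).symm
    · simp
  have hk' : ∀ x, ∀ t ∈ Ico 0 r, HasSum (fun m : ℕ =>
      (t : 𝕜) ^ m • PowerSeries.coeff m (kernelSeries 𝕜 fun n => P * l n) x) (k x t) := by
    intro x t ht
    refine (hk x t ht).congr_fun fun m => ?_
    rw [h.iteratedDerivWithin_kernel, ← coe_pow_smul_inv_factorial_smul (𝕜 := 𝕜), kernelSeries,
      PowerSeries.coeff_mk]
    rfl
  have ht : r / 2 ∈ Ico 0 r := ⟨by positivity, by linarith⟩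
  obtain ⟨C₁, hC₁, h1⟩ := exists_norm_coeff_le (half_pos hr) fun x => (hp' x _ ht).summable
  obtain ⟨C₂, hC₂, h2⟩ := exists_norm_coeff_le (half_pos hr) fun x => (hk' x _ ht).summable
  have h3 : ∀ n, ‖PowerSeries.coeff n (shiftTwo (expSeries 𝕜 fun n => P * l n))‖ ≤
      C₁ * (r / 2)⁻¹ ^ 2 * (r / 2)⁻¹ ^ n := by
    intro n
    rw [shiftTwo, PowerSeries.coeff_mk]
    exact (h1 (n + 2)).trans_eq (by ring)
  obtain ⟨D, r₁, hD, hr₁, h4⟩ := exists_norm_coeff_cornerInverse_le (P := P)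
    (u := h.unit hPb hbP hab hba) (by positivity) (by positivity) h3
  rw [← hE] at h4
  exact h.exists_hasSum_expansionTerm (hE ▸ h.isDivisor_cornerInverse hPb hbP hab hba) hr hC₁ hC₂ hD
    (by positivity) h1 h2 hr₁ h4 hp' hk'

end Kernel

end MoriZwanzig

open MoriZwanzig in
theorem corollary1 {𝕜 X : Type*} [RCLike 𝕜] [NormedAddCommGroup X] [NormedSpace ℝ X]
    [NormedSpace 𝕜 X] [IsScalarTower ℝ 𝕜 X] [CompleteSpace X]
    -- the projections
    (P Q : X →L[𝕜] X) (hPQ : P + Q = 1) (hPQ0 : P * Q = 0)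
    -- the closures of `L` and `QL` generate the semigroups `T t = e^{tL}` and `S t = e^{tQL}`
    (L : X →ₗ.[𝕜] X) (T S : ℝ → X →L[𝕜] X)
    (hL : L.IsClosable) (hT : Generates L.closure T)
    (hQL : ((Q : X →ₗ[𝕜] X).compPMap L).IsClosable)
    (hS : Generates ((Q : X →ₗ[𝕜] X).compPMap L).closure S)
    -- differentiability in time up to any order
    (hdom : ∀ n, LinearMap.range (P : X →ₗ[𝕜] X) ≤ (ppow L.closure n).domain)
    (hmem : ∀ x : X, ∀ t : ℝ, 0 ≤ t → S t (Q (pval L.closure (P x))) ∈ L.closure.domain)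
    (hsmooth : ∀ x : X, ContDiffOn ℝ ∞ (memoryKernel P Q L.closure S x) (Ici 0))
    -- the operators `a i = P L^i P`
    (a : ℕ → Module.End 𝕜 X) (ha : ∀ i, a i = compressedPow (P : X →ₗ[𝕜] X) L.closure hdom i)
    (hodd : ∀ k, a (2 * k + 1) = 0)
    -- `P L^2 P` is invertible in `V ⊇ Ran P`, with inverse `J`
    (V : Submodule 𝕜 X) (hV : LinearMap.range (P : X →ₗ[𝕜] X) ≤ V)
    (J : Module.End 𝕜 V) (hJ : IsInverseOn V (a 2) J) :
    ∃ F : ℕ → X →L[𝕜] X,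
      -- the operators `F n` act after `P`
      (∀ n, F n * P = F n) ∧
      -- they solve the algebraic equation, and are its only solution
      SolvesWordEquation 𝕜 a (fun n => (F n : X →ₗ[𝕜] X)) ∧
      (∀ G : ℕ → Module.End 𝕜 X, (∀ n, G n * (P : X →ₗ[𝕜] X) = G n) →
        SolvesWordEquation 𝕜 a G → ∀ n, G n = (F n : X →ₗ[𝕜] X)) ∧
      -- they are constructed recursively from the equations of even order
      (∀ n, 1 ≤ n → ∀ v : V,
        F n (v : X) = ((n ! * 2 ^ n : 𝕜) / ((2 * n)! : 𝕜)) •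
          (bipartition a (2 * n + 2) -
            ∑ k ∈ Finset.Ico 1 n, ((F k : X →ₗ[𝕜] X) : Module.End 𝕜 X) * bellII 𝕜 a (2 * n) k)
            ((J ^ n) v : X)) ∧
      -- the Dyson identity to all orders in `t`
      (∀ x : X, DifferentiableOn ℝ (projected P T x) (Ici 0)) ∧
      (∀ x : X, ∀ N : ℕ,
        (fun t => derivWithin (projected P T x) (Ici 0) t - P (T t (a 1 x)) -
            ∑ n ∈ Finset.range (N + 1), expansionTerm P T F n t x)
          =O[𝓝[≥] 0] fun t : ℝ => t ^ (2 * N + 3)) ∧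
      -- the Dyson identity with a convergent series, if the Taylor series converge
      (∀ r > 0, TaylorConverges (projected P T) r →
        TaylorConverges (memoryKernel P Q L.closure S) r →
        ∃ δ > 0, ∀ x : X, ∀ t ∈ Ico 0 δ,
          Summable (fun n => expansionTerm P T F n t x) ∧
          derivWithin (projected P T x) (Ici 0) t =
            P (T t (a 1 x)) + ∑' n, expansionTerm P T F n t x) := by
  have hP : P * P = P := by
    have := congrArg (fun B => P * B) hPQ
    simpa [mul_add, hPQ0] using this
  obtain ⟨l, hl0, hl, hal⟩ := exists_compressedPow_eq hL.closure_isClosed P hdom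
  -- The equation is solved among bounded operators and transported to all linear endomorphisms,
  -- where uniqueness is claimed.
  have ha' : a = fun n => toEndAlgHom 𝕜 X (P * l n) := funext fun n => (ha n).trans (hal n)
  have hodd' : ∀ j, P * l (2 * j + 1) = 0 := fun j => by
    have := hodd j
    rw [ha'] at this
    exact ContinuousLinearMap.coe_injective this
  have h := isDysonSystem_memoryKernel hPQ hPQ0 hL hT hQL hS hl0 hl hodd' hmem hsmooth
  have hJ' : IsInverseOn V ((P * l 2 : X →L[𝕜] X) : X →ₗ[𝕜] X) J := by
    rw [ha'] at hJ
    exact hJ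
  obtain ⟨b, hPb, hbP, hab, hba⟩ := hJ'.exists_cornerInverse hP (h.coeff_mul 2) hV
  set E := cornerInverse (shiftTwo (expSeries 𝕜 fun n => P * l n)) P
    (h.unit hPb hbP hab hba) with hE
  have hdiv : IsDysonSystem.IsDivisor P l E := h.isDivisor_cornerInverse hPb hbP hab hba
  have hsolve := h.solvesWordEquation hdiv
  have hsolve' := hsolve.map (toEndAlgHom 𝕜 X)
  have ha1 : a 1 = 0 := hodd 0
  set F : ℕ → X →L[𝕜] X := fun n => (n ! : 𝕜) • IsDysonSystem.expansionCoeff l P E n with hF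
  have hFP : ∀ n, F n * P = F n := fun n => by
    rw [hF, smul_mul_assoc, h.expansionCoeff_mul hdiv]
  rw [← ha'] at hsolve'
  refine ⟨F, hFP, hsolve', fun G hGP hG n => ?_, fun n hn v => ?_,
    h.differentiableOn_projected, fun x N => ?_, fun r hr hp hk => ?_⟩
  · refine solvesWordEquation_unique (P := toEndAlgHom 𝕜 X P) (b := toEndAlgHom 𝕜 X b) ha1 ?_ ?_
      hsolve' (fun n => ?_) hG hGP n
    · rw [← map_mul, hPb]
    · rw [ha', ← map_mul, hab]
    · rw [← map_mul, hFP]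
  · have h1 := congrArg (fun B : Module.End 𝕜 X => B ((J ^ n) v : X))
      (bipartition_sub_sum_eq ha1 hsolve' hn)
    have h2 : ∀ m, (a 2 ^ m) ((J ^ m) v : X) = v := by
      intro m
      induction m with
      | zero => rfl
      | succ m ih =>
        rw [pow_succ, pow_succ']
        change (a 2 ^ m) (a 2 (J ((J ^ m) v) : X)) = v
        rw [hJ.2.1, ih]
    refine Eq.trans ?_ h1.symm
    change _ = F n ((a 2 ^ n) ((J ^ n) v : X))
    rw [h2]
  -- Truncation after `n = N` keeps `N + 1` terms, whence the exponent `2(N+1) + 1`.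
  · have h1 := h.isBigO_dyson_sub_sum hdiv (N + 1) x
    rw [show 2 * (N + 1) + 1 = 2 * N + 3 by ring] at h1
    simpa [ha1] using h1
  · obtain ⟨δ, hδ, h1⟩ := h.exists_hasSum_of_taylorConverges hPb hbP hab hba hE hr hp hk
    refine ⟨δ, hδ, fun x t ht => ⟨(h1 x t ht).summable, ?_⟩⟩
    rw [(h1 x t ht).tsum_eq, ha1]
    simp
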